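/- Let $L>0$, $\mathcal Z=\mathbb Z^2\setminus\{0\}$, and let $|k|$ be the Euclidean norm of $k$. For $k\in\mathcal Z$ and $x\in[0,L]^2$ put $e_k(x)=\omega_{k_1}(x_1)\,\omega_{k_2}(x_2)$, where $\omega_n(z)=\sqrt{2/L}\,\sin(2\pi n z/L)$ for $n>0$, $\omega_0(z)=1/\sqrt L$, and $\omega_n(z)=\sqrt{2/L}\,\cos(2\pi n z/L)$ for $n<0$, and put $\mu_k=(2\pi|k|/L)^2$. Let $(\beta_k)_{k\in\mathcal Z}$ be independent standard real-valued Brownian motions on a probability space $(\Omega,\mathcal A,\mathbb P)$. For every $\varepsilon>0$ let $(\alpha_k^{(\varepsilon)})_{k\in\mathcal Z}$ be real numbers such that: $\sup_{\varepsilon>0}\sup_{k\in\mathcal Z}|\alpha_k^{(\varepsilon)}|<\infty$; for every $\varepsilon>0$ there is $\delta(\varepsilon)>0$ with $\alpha_k^{(\varepsilon)}=\mathcal O(|k|^{-\delta(\varepsilon)})$ (the constant may depend on $\varepsilon$); $\alpha_k^{(\varepsilon)}$ depends on $k$ only through $|k|$; and $\alpha_k^{(\varepsilon)}\to1$ as $\varepsilon\to0$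 for every $k\in\mathcal Z$. Define, for $t\ge0$ and $x\in[0,L]^2$, $$Z_k(t)=\int_0^t e^{-(t-s)\mu_k^2}\,d\beta_k(s),\qquad Z(t,x)=\sum_{k\in\mathcal Z}Z_k(t)\,e_k(x),\qquad Z_\varepsilon(t,x)=\sum_{k\in\mathcal Z}\alpha_k^{(\varepsilon)}Z_k(t)\,e_k(x),$$ where the stochastic integrals are Wiener integrals and the series are taken in $L^2(\Omega)$. Theorem. Let $T>0$ and $1<p<\infty$. For all $(t,x)\in[0,T]\times[0,L]^2$ the series defining $Z(t,x)$ and $Z_\varepsilon(t,x)$, $\varepsilon>0$, converge in $L^2(\Omega)$; the random fields $Z$ and $Z_\varepsilon$ have versions with continuous paths on $[0,T]\times[0,L]^2$ that belong to $L^p\big(\Omega,C^0([0,T]\times[0,L]^2)\big)$; and, for these versions, $Z_\varepsilon\to Z$ in $L^p\big(\Omega,C^0([0,T]\times[0,L]^2)\big)$ as $\varepsilon\to0$, that is, $$\lim_{\varepsilon\to0}\ \mathbb E\Big[\sup_{(t,x)\in[0,T]\times[0,L]^2}|Z_\varepsilon(t,x)-Z(t,x)|^p\Big]=0 .$$ 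-/

import Mathlib

open MeasureTheory ProbabilityTheory Filter Topology
open scoped NNReal ENNReal

namespace ThinFilm

noncomputable section

/-! ### Fourier modes on the square `[0, L]²` with periodic boundary conditions -/

/-- The set `ℤ² \ {0}` of nonzero Fourier modes. -/
abbrev Mode : Type := {k : ℤ × ℤ // k ≠ 0}

/-- The Euclidean length `|k|` of a mode. -/
def Mode.len (k : Mode) : ℝ := Real.sqrt ((k.1.1 : ℝ) ^ 2 + (k.1.2 : ℝ) ^ 2)

/-- The orthonormal trigonometric basis of `L²([0, L])`: sines for positive frequencies, the
constant for frequency zero, cosines for negative frequencies. -/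
def trigBasis (L : ℝ) (n : ℤ) (z : ℝ) : ℝ :=
  if 0 < n then Real.sqrt (2 / L) * Real.sin (2 * Real.pi * n / L * z)
  else if n = 0 then 1 / Real.sqrt L
  else Real.sqrt (2 / L) * Real.cos (2 * Real.pi * n / L * z)

/-- The eigenfunction `e_k(x) = ω_{k₁}(x₁) ω_{k₂}(x₂)` of the periodic Laplacian. -/
def eigenfun (L : ℝ) (k : Mode) (x : ℝ × ℝ) : ℝ :=
  trigBasis L k.1.1 x.1 * trigBasis L k.1.2 x.2

/-- The eigenvalue `μ_k = (2 π |k| / L)²` of `-Δ` belonging to `e_k`. -/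
def eigenval (L : ℝ) (k : Mode) : ℝ := (2 * Real.pi * k.len / L) ^ 2

/-! ### The Wiener integral of a deterministic integrand -/

variable {Ω : Type*} [MeasurableSpace Ω]

/-- Formal linear combinations of intervals: the pair `(a, h)` stands for `(a, a + h]`. -/
abbrev StepData : Type := ℝ≥0 × ℝ≥0 →₀ ℝ

/-- The step function `∑ r 1_{(a, a + h]}`. -/
def StepData.toFun (c : StepData) (s : ℝ) : ℝ :=
  c.sum fun q r => r * (Set.Ioc (q.1 : ℝ) ((q.1 : ℝ) + (q.2 : ℝ))).indicator (fun _ => (1 : ℝ)) s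

/-- The elementary integral `∑ r (B(a + h) - B(a))` of that step function against `B`. -/
def StepData.integral (B : ℝ≥0 → Ω → ℝ) (c : StepData) (ω : Ω) : ℝ :=
  c.sum fun q r => r * (B (q.1 + q.2) ω - B q.1 ω)

open Classical in
/-- The class in `L²(Ω)` of a square integrable random variable (and `0` for other functions). -/
def toL2 (P : Measure Ω) (X : Ω → ℝ) : Lp ℝ 2 P :=
  if h : MemLp X 2 P then h.toLp X else 0

/-- The Wiener integral `∫₀^∞ f dB` in `L²(Ω)` of a square integrable `f` supported in `[0, ∞)`
against a Brownian motion `B`: the limit in `L²(Ω)` of the elementary integrals of step functions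
`φ`, as `φ → f` in `L²(ℝ)`. -/
def wienerIntegral (B : ℝ≥0 → Ω → ℝ) (P : Measure Ω) (f : ℝ → ℝ) : Lp ℝ 2 P :=
  limUnder
    (comap (fun c : StepData => eLpNorm (fun s => c.toFun s - f s) 2 (volume : Measure ℝ)) (𝓝 0))
    (fun c : StepData => toL2 P (c.integral B))

/-! ### Cylindrical Wiener process and stochastic convolution -/

/-- The coefficients of a cylindrical Wiener process: independent standard real Brownian motions,
one for each nonzero mode. -/
structure IsCylindricalWiener (β : Mode → ℝ≥0 → Ω → ℝ) (P : Measure Ω) : Prop where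
  brownian : ∀ k, IsBrownianReal (β k) P
  indep : iIndepFun (fun k ω t => β k t ω) P

/-- `Z_k(t) = ∫₀ᵗ exp(-(t - s) μ_k²) dβ_k(s)`. -/
def convCoeff (L : ℝ) (β : Mode → ℝ≥0 → Ω → ℝ) (P : Measure Ω) (k : Mode) (t : ℝ) :
    Lp ℝ 2 P :=
  wienerIntegral (β k) P
    ((Set.Ioc 0 t).indicator fun s => Real.exp (-(t - s) * eigenval L k ^ 2))

/-- The summand `a_k e_k(x) Z_k(t)`. -/
def convTerm (L : ℝ) (β : Mode → ℝ≥0 → Ω → ℝ) (P : Measure Ω) (a : Mode → ℝ) (t : ℝ)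
    (x : ℝ × ℝ) (k : Mode) : Lp ℝ 2 P :=
  (a k * eigenfun L k x) • convCoeff L β P k t

/-- The random variable `∑_k a_k Z_k(t) e_k(x)`, the series being taken in `L²(Ω)`. For `a = 1`
this is the stochastic convolution `Z(t, x)`, for `a = α^{(ε)}` it is `Z_ε(t, x)`. -/
def stochConv (L : ℝ) (β : Mode → ℝ≥0 → Ω → ℝ) (P : Measure Ω) (a : Mode → ℝ) (t : ℝ)
    (x : ℝ × ℝ) : Lp ℝ 2 P :=
  ∑' k, convTerm L β P a t x k

/-- The regularizing coefficients `α_k^{(ε)}`, `ε > 0`. -/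
structure IsRegularization (α : ℝ → Mode → ℝ) : Prop where
  bounded : ∃ M : ℝ, ∀ ε, 0 < ε → ∀ k, |α ε k| ≤ M
  decay : ∀ ε, 0 < ε → ∃ δ : ℝ, 0 < δ ∧ ∃ C : ℝ, ∀ k : Mode, |α ε k| ≤ C * k.len ^ (-δ)
  radial : ∀ ε, 0 < ε → ∀ k l : Mode, k.len = l.len → α ε k = α ε l
  tendsto_one : ∀ k, Tendsto (fun ε => α ε k) (𝓝[>] 0) (𝓝 1)

/-- The space-time domain `[0, T] × [0, L]²`. -/
abbrev Domain (T L : ℝ) : Type := Set.Icc (0 : ℝ) T × (Set.Icc (0 : ℝ) L × Set.Icc (0 : ℝ) L)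

/-- The random continuous function `X` on `[0, T] × [0, L]²` is a version of the random field
`∑_k a_k Z_k(t) e_k(x)`: at every point the series converges in `L²(Ω)` and its sum is, almost
surely, the value of `X`. -/
structure IsContinuousVersion (T L : ℝ) (β : Mode → ℝ≥0 → Ω → ℝ) (P : Measure Ω) (a : Mode → ℝ)
    (X : Ω → C(Domain T L, ℝ)) : Prop where
  summable : ∀ z : Domain T L, Summable (convTerm L β P a z.1 (z.2.1, z.2.2))
  ae_eq : ∀ z : Domain T L, (fun ω => X ω z) =ᵐ[P] stochConv L β P a z.1 (z.2.1, z.2.2)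

end

end ThinFilm

/-! The field is linear in the coefficients `a`, so one estimate, linear in `a`, gives existence for
`a = 1` and `a = α ε` and convergence for `a = α ε - 1`: a continuous version exists whose norm in
`L^q(Ω, C)` is at most `C √S(a)`, where `S(a) = ∑ a_k² |k|⁻³` and `C` does not depend on `a`
(`exists_continuous_version_stochConv`). By dominated convergence `S(α ε - 1) → 0`.

Three facts carry the estimate. The Itô isometry gives `E Z_k(t)² ≲ |k|⁻⁴` and `E |Z_k(t) - Z_k(s)|²
≲ min(|k|⁻⁴, |t - s|)`. Independence makes different modes orthogonal, so squared norms add up;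
interpolating between decay and regularity leaves `|k|⁻³`, summable over `ℤ²`, and a squared `L²`
increment of order `S(a) d^(1/4)` at distance `d`. All variables involved lie in one closed centred
Gaussian subspace (`gaussSpace`), where `L^q` norms are bounded by multiples of the `L²` norm, so
the field is `1/8`-Hölder in every `L^q`, `q < ∞`.

A Kolmogorov-Chentsov argument (`exists_continuous_version`), run inside the Banach space `L^q(Ω,
C(D))`, then produces the version: interpolations of the field on finer and finer nets form a
geometric Cauchy sequence once `q` is large. -/

namespace ThinFilm

noncomputable section

open scoped RealInnerProductSpace

/-! ### Wiener integrals, the Itô isometry and Ornstein-Uhlenbeck covariances. -/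

section WienerIntegral

variable {Ω : Type*} [MeasurableSpace Ω]

/-! ### Elementary integrals as an isometry -/

/-- The step function of `c` as an element of `L²(ℝ)`. -/
def stepL2 : StepData →ₗ[ℝ] Lp ℝ 2 (volume : Measure ℝ) :=
  Finsupp.linearCombination ℝ fun q : ℝ≥0 × ℝ≥0 =>
    indicatorConstLp 2 (measurableSet_Ioc (a := (q.1 : ℝ)) (b := (q.1 : ℝ) + (q.2 : ℝ)))
      measure_Ioc_lt_top.ne (1 : ℝ)

/-- The elementary integral of `c` as an element of `L²(Ω)`. -/
def elemIntegral (B : ℝ≥0 → Ω → ℝ) (P : Measure Ω) : StepData →ₗ[ℝ] Lp ℝ 2 P :=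
  Finsupp.linearCombination ℝ fun q : ℝ≥0 × ℝ≥0 => toL2 P fun ω => B (q.1 + q.2) ω - B q.1 ω

lemma StepData.toFun_add (c d : StepData) : (c + d).toFun = c.toFun + d.toFun := by
  ext s
  simp only [StepData.toFun, Pi.add_apply]
  exact Finsupp.sum_add_index' (by simp) (by intros; ring)

lemma StepData.toFun_single (q : ℝ≥0 × ℝ≥0) (r : ℝ) :
    StepData.toFun (Finsupp.single q r) =
      r • (Set.Ioc (q.1 : ℝ) ((q.1 : ℝ) + (q.2 : ℝ))).indicator (fun _ => (1 : ℝ)) := by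
  ext s
  simp [StepData.toFun]

lemma StepData.integral_add {Ω : Type*} (B : ℝ≥0 → Ω → ℝ) (c d : StepData) :
    StepData.integral B (c + d) = StepData.integral B c + StepData.integral B d := by
  ext s
  simp only [StepData.integral, Pi.add_apply]
  exact Finsupp.sum_add_index' (by simp) (by intros; ring)

lemma StepData.integral_single {Ω : Type*} (B : ℝ≥0 → Ω → ℝ) (q : ℝ≥0 × ℝ≥0) (r : ℝ) :
    StepData.integral B (Finsupp.single q r) = r • fun ω => B (q.1 + q.2) ω - B q.1 ω := by
  ext s
  simp [StepData.integral]

lemma coeFn_stepL2 (c : StepData) : stepL2 c =ᵐ[volume] c.toFun := by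
  induction c using Finsupp.induction_linear with
  | zero =>
    have : StepData.toFun 0 = 0 := by ext; simp [StepData.toFun]
    rw [map_zero, this]
    exact Lp.coeFn_zero _ _ _
  | add c d hc hd =>
    rw [map_add, StepData.toFun_add]
    exact (Lp.coeFn_add _ _).trans (hc.add hd)
  | single q r =>
    rw [StepData.toFun_single, stepL2, Finsupp.linearCombination_single]
    exact (Lp.coeFn_smul _ _).trans (indicatorConstLp_coeFn.const_smul r)

lemma coeFn_toL2 {P : Measure Ω} {X : Ω → ℝ} (h : MemLp X 2 P) : toL2 P X =ᵐ[P] X := by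
  rw [toL2, dif_pos h]
  exact h.coeFn_toLp

lemma toL2_congr {P : Measure Ω} {X Y : Ω → ℝ} (h : X =ᵐ[P] Y) : toL2 P X = toL2 P Y := by
  by_cases hX : MemLp X 2 P
  · have hY := hX.ae_eq h
    rw [toL2, toL2, dif_pos hX, dif_pos hY]
    exact MemLp.toLp_congr hX hY h
  · have hY : ¬ MemLp Y 2 P := fun hY => hX (hY.ae_eq h.symm)
    rw [toL2, toL2, dif_neg hX, dif_neg hY]

lemma toL2_coeFn {P : Measure Ω} (X : Lp ℝ 2 P) : toL2 P X = X := by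
  rw [toL2, dif_pos (Lp.memLp X), Lp.toLp_coeFn]

variable {P : Measure Ω} {B : ℝ≥0 → Ω → ℝ}

lemma memLp_increment (hB : IsPreBrownianReal B P) (s t : ℝ≥0) :
    MemLp (fun ω => B s ω - B t ω) 2 P :=
  hB.isGaussianProcess.hasGaussianLaw_fun_sub.memLp_two

lemma coeFn_elemIntegral (hB : IsPreBrownianReal B P) (c : StepData) :
    elemIntegral B P c =ᵐ[P] c.integral B := by
  induction c using Finsupp.induction_linear with
  | zero =>
    have : StepData.integral B 0 = 0 := by ext; simp [StepData.integral]
    rw [map_zero, this]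
    exact Lp.coeFn_zero _ _ _
  | add c d hc hd =>
    rw [map_add, StepData.integral_add]
    exact (Lp.coeFn_add _ _).trans (hc.add hd)
  | single q r =>
    rw [StepData.integral_single, elemIntegral, Finsupp.linearCombination_single]
    exact (Lp.coeFn_smul _ _).trans ((coeFn_toL2 (memLp_increment hB _ _)).const_smul r)

lemma toL2_integral (hB : IsPreBrownianReal B P) (c : StepData) :
    toL2 P (c.integral B) = elemIntegral B P c := by
  rw [← toL2_congr (coeFn_elemIntegral hB c), toL2_coeFn]

lemma integral_mul_eval [IsProbabilityMeasure P] (hB : IsPreBrownianReal B P) (s t : ℝ≥0) :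
    ∫ ω, B s ω * B t ω ∂P = min (s : ℝ) t := by
  have h := covariance_eq_sub (hB.isGaussianProcess.hasGaussianLaw_eval s).memLp_two
    (hB.isGaussianProcess.hasGaussianLaw_eval t).memLp_two
  rw [hB.covariance_eval, hB.integral_eval, zero_mul, sub_zero] at h
  simpa using h.symm

lemma integral_mul_increment [IsProbabilityMeasure P] (hB : IsPreBrownianReal B P)
    (s t u v : ℝ≥0) :
    ∫ ω, (B s ω - B t ω) * (B u ω - B v ω) ∂P =
      min (s : ℝ) u - min (s : ℝ) v - min (t : ℝ) u + min (t : ℝ) v := by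
  have m (r : ℝ≥0) := (hB.isGaussianProcess.hasGaussianLaw_eval r).memLp_two
  have i (r r' : ℝ≥0) : Integrable (fun ω => B r ω * B r' ω) P := (m r).integrable_mul (m r')
  have h (ω : Ω) : (B s ω - B t ω) * (B u ω - B v ω) =
      B s ω * B u ω - B s ω * B v ω - B t ω * B u ω + B t ω * B v ω := by ring
  simp_rw [h]
  have i₂ : Integrable (fun ω => B s ω * B u ω - B s ω * B v ω) P := (i _ _).sub (i _ _)
  have i₃ : Integrable (fun ω => B s ω * B u ω - B s ω * B v ω - B t ω * B u ω) P := i₂.sub (i _ _)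
  rw [integral_add i₃ (i _ _), integral_sub i₂ (i _ _), integral_sub (i _ _) (i _ _)]
  simp_rw [integral_mul_eval hB]

/-- Both sides are bilinear, so single intervals suffice; there the four covariances `min` combine
to the length of the intersection of the intervals. -/
lemma inner_elemIntegral [IsProbabilityMeasure P] (hB : IsPreBrownianReal B P) (c d : StepData) :
    ⟪elemIntegral B P c, elemIntegral B P d⟫ = ⟪stepL2 c, stepL2 d⟫ := by
  have key (q r : ℝ≥0 × ℝ≥0) :
      ⟪toL2 P fun ω => B (q.1 + q.2) ω - B q.1 ω, toL2 P fun ω => B (r.1 + r.2) ω - B r.1 ω⟫ =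
        ⟪stepL2 (Finsupp.single q 1), stepL2 (Finsupp.single r 1)⟫ := by
    rw [L2.inner_def, stepL2, Finsupp.linearCombination_single, Finsupp.linearCombination_single,
      one_smul, one_smul]
    have h : (fun ω => ⟪(toL2 P fun ω => B (q.1 + q.2) ω - B q.1 ω) ω,
        (toL2 P fun ω => B (r.1 + r.2) ω - B r.1 ω) ω⟫) =ᵐ[P]
        fun ω => (B (q.1 + q.2) ω - B q.1 ω) * (B (r.1 + r.2) ω - B r.1 ω) := by
      filter_upwards [coeFn_toL2 (memLp_increment hB (q.1 + q.2) q.1),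
        coeFn_toL2 (memLp_increment hB (r.1 + r.2) r.1)] with ω h1 h2
      rw [h1, h2]
      simp [mul_comm]
    rw [integral_congr_ae h, integral_mul_increment hB, L2.inner_indicatorConstLp_indicatorConstLp
        measurableSet_Ioc measurableSet_Ioc measure_Ioc_lt_top.ne measure_Ioc_lt_top.ne,
      Set.Ioc_inter_Ioc]
    have h1 := q.2.coe_nonneg
    have h2 := r.2.coe_nonneg
    simp [Measure.real, Real.volume_Ioc, ENNReal.toReal_ofReal']
    grind
  have : (innerₗ (Lp ℝ 2 P)).compl₁₂ (elemIntegral B P) (elemIntegral B P) =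
      (innerₗ (Lp ℝ 2 (volume : Measure ℝ))).compl₁₂ stepL2 stepL2 := by
    ext q r
    simpa [elemIntegral] using key q r
  exact congrArg (fun f => f c d) this

lemma norm_elemIntegral [IsProbabilityMeasure P] (hB : IsPreBrownianReal B P) (c : StepData) :
    ‖elemIntegral B P c‖ = ‖stepL2 c‖ := by
  rw [@norm_eq_sqrt_real_inner, @norm_eq_sqrt_real_inner, inner_elemIntegral hB]

/-! ### Characterization of the Wiener integral -/

/-- The isometry turns approximating step functions into a Cauchy sequence in `L²(Ω)`. Its limit is
as far from each elementary integral as `f` is from the step function, so the limit exists along the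
whole filter and not only along one sequence. -/
lemma wienerIntegral_spec [IsProbabilityMeasure P] (hB : IsPreBrownianReal B P) {f : ℝ → ℝ}
    (hf : MemLp f 2 (volume : Measure ℝ))
    (hcl : hf.toLp f ∈ closure (Set.range stepL2)) (c : StepData) :
    ‖elemIntegral B P c - wienerIntegral B P f‖ = ‖stepL2 c - hf.toLp f‖ := by
  obtain ⟨x, hx, hxF⟩ := mem_closure_iff_seq_limit.1 hcl
  choose a ha using hx
  obtain rfl : (fun n => stepL2 (a n)) = x := funext ha
  have hdist (c d : StepData) :
      ‖elemIntegral B P c - elemIntegral B P d‖ = ‖stepL2 c - stepL2 d‖ := by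
    rw [← map_sub, ← map_sub, norm_elemIntegral hB]
  have hc : CauchySeq fun n => elemIntegral B P (a n) := by
    have := hxF.cauchySeq
    rw [Metric.cauchySeq_iff] at this ⊢
    simpa only [dist_eq_norm, hdist] using this
  obtain ⟨Y, hY⟩ := cauchySeq_tendsto_of_complete hc
  have hYc (c : StepData) : ‖elemIntegral B P c - Y‖ = ‖stepL2 c - hf.toLp f‖ :=
    tendsto_nhds_unique ((tendsto_const_nhds.sub hY).norm.congr fun n => hdist c (a n))
      (tendsto_const_nhds.sub hxF).norm
  have hfilter (c : StepData) :
      eLpNorm (fun s => c.toFun s - f s) 2 (volume : Measure ℝ) = ‖stepL2 c - hf.toLp f‖ₑ := by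
    rw [Lp.enorm_def]
    refine eLpNorm_congr_ae ?_
    filter_upwards [coeFn_stepL2 c, hf.coeFn_toLp, Lp.coeFn_sub (stepL2 c) (hf.toLp f)]
      with s h1 h2 h3
    rw [h3, Pi.sub_apply, h1, h2]
  have hw : wienerIntegral B P f = Y := by
    rw [wienerIntegral]
    simp_rw [hfilter, toL2_integral hB]
    -- Limits are unique only along a nontrivial filter; this is where approximability of `f` by
    -- step functions enters.
    have : NeBot (comap (fun c : StepData => ‖stepL2 c - hf.toLp f‖ₑ) (𝓝 0)) := by
      have ht : Tendsto (fun n => ‖stepL2 (a n) - hf.toLp f‖ₑ) atTop (𝓝 0) := by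
        simpa using (hxF.sub_const (hf.toLp f)).enorm
      exact NeBot.mono (f := map a atTop) inferInstance (tendsto_comap_iff.2 ht)
    refine Tendsto.limUnder_eq ?_
    rw [tendsto_iff_norm_sub_tendsto_zero]
    simp_rw [hYc]
    refine ((ENNReal.tendsto_toReal ENNReal.zero_ne_top).comp
      (tendsto_comap (f := fun c : StepData => ‖stepL2 c - hf.toLp f‖ₑ) (x := 𝓝 0))).congr ?_
    exact fun c => toReal_enorm _
  rw [hw, hYc]

lemma exists_seq_tendsto_wienerIntegral [IsProbabilityMeasure P] (hB : IsPreBrownianReal B P)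
    {f : ℝ → ℝ} (hf : MemLp f 2 (volume : Measure ℝ))
    (hcl : hf.toLp f ∈ closure (Set.range stepL2)) :
    ∃ a : ℕ → StepData, Tendsto (fun n => stepL2 (a n)) atTop (𝓝 (hf.toLp f)) ∧
      Tendsto (fun n => elemIntegral B P (a n)) atTop (𝓝 (wienerIntegral B P f)) := by
  obtain ⟨x, hx, hxF⟩ := mem_closure_iff_seq_limit.1 hcl
  choose a ha using hx
  obtain rfl : (fun n => stepL2 (a n)) = x := funext ha
  refine ⟨a, hxF, ?_⟩
  rw [tendsto_iff_norm_sub_tendsto_zero] at hxF ⊢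
  simpa only [wienerIntegral_spec hB hf hcl] using hxF

lemma wienerIntegral_mem_closure [IsProbabilityMeasure P] (hB : IsPreBrownianReal B P)
    {f : ℝ → ℝ} (hf : MemLp f 2 (volume : Measure ℝ))
    (hcl : hf.toLp f ∈ closure (Set.range stepL2)) :
    wienerIntegral B P f ∈ (LinearMap.range (elemIntegral B P)).topologicalClosure := by
  obtain ⟨a, -, ha⟩ := exists_seq_tendsto_wienerIntegral hB hf hcl
  exact mem_closure_of_tendsto ha (Eventually.of_forall fun n => ⟨a n, rfl⟩)

/-- The Itô isometry for deterministic integrands, in polarized form. -/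
lemma inner_wienerIntegral [IsProbabilityMeasure P] (hB : IsPreBrownianReal B P)
    {f g : ℝ → ℝ} (hf : MemLp f 2 (volume : Measure ℝ)) (hg : MemLp g 2 (volume : Measure ℝ))
    (hfcl : hf.toLp f ∈ closure (Set.range stepL2))
    (hgcl : hg.toLp g ∈ closure (Set.range stepL2)) :
    ⟪wienerIntegral B P f, wienerIntegral B P g⟫ = ∫ s, f s * g s := by
  obtain ⟨a, ha, ha'⟩ := exists_seq_tendsto_wienerIntegral hB hf hfcl
  obtain ⟨b, hb, hb'⟩ := exists_seq_tendsto_wienerIntegral hB hg hgcl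
  have h := tendsto_nhds_unique ((ha'.inner hb').congr fun n => inner_elemIntegral hB _ _)
    (ha.inner hb)
  rw [h, L2.inner_def]
  refine integral_congr_ae ?_
  filter_upwards [hf.coeFn_toLp, hg.coeFn_toLp] with s h1 h2
  rw [h1, h2]
  simp [mul_comm]

/-! ### The exponential kernel -/

/-- The integrand `1_{(0,t]}(s) exp(-(t - s) l)` of the Ornstein-Uhlenbeck process. -/
def expKernel (l t : ℝ) : ℝ → ℝ := (Set.Ioc 0 t).indicator fun s => Real.exp (-(t - s) * l)

lemma memLp_expKernel (l t : ℝ) : MemLp (expKernel l t) 2 (volume : Measure ℝ) := by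
  have hc : Continuous fun s : ℝ => Real.exp (-(t - s) * l) := by fun_prop
  have h : MemLp (fun s : ℝ => Real.exp (-(t - s) * l)) 2 (volume.restrict (Set.Icc 0 t)) := by
    obtain ⟨C, hC⟩ := isCompact_Icc.exists_bound_of_continuousOn (hc.continuousOn (s := Set.Icc 0 t))
    exact MemLp.of_bound hc.aestronglyMeasurable C
      ((ae_restrict_mem measurableSet_Icc).mono fun s hs => hC s hs)
  exact (memLp_indicator_iff_restrict measurableSet_Ioc).2
    (h.mono_measure (Measure.restrict_mono Set.Ioc_subset_Icc_self le_rfl))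

lemma indicator_Ioc_eq_sum (h : ℝ≥0) (n : ℕ) (s : ℝ) :
    (Set.Ioc (0 : ℝ) (n * h)).indicator (fun _ => (1 : ℝ)) s =
      ∑ i ∈ Finset.range n, (Set.Ioc (i * h : ℝ) (i * h + h)).indicator (fun _ => (1 : ℝ)) s := by
  induction n with
  | zero => simp
  | succ n ih =>
    rw [Finset.sum_range_succ, ← ih]
    have h0 : (0 : ℝ) ≤ n * h := by positivity
    have h1 : (0 : ℝ) ≤ h := h.coe_nonneg
    simp only [Set.indicator_apply, Set.mem_Ioc, Nat.cast_add, Nat.cast_one, add_mul, one_mul]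
    grind

lemma abs_exp_kernel_sub_le {l t s r : ℝ} (hl : 0 ≤ l) (hs : s ≤ r) (hr : r ≤ t) :
    |Real.exp (-(t - r) * l) - Real.exp (-(t - s) * l)| ≤ (r - s) * l := by
  have h1 : Real.exp (-(t - s) * l) ≤ Real.exp (-(t - r) * l) := by
    gcongr
  rw [abs_of_nonneg (sub_nonneg.2 h1)]
  have h2 : Real.exp (-(t - s) * l) = Real.exp (-(t - r) * l) * Real.exp (-((r - s) * l)) := by
    rw [← Real.exp_add]; ring_nf
  have h3 : Real.exp (-(t - r) * l) ≤ 1 := by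
    rw [Real.exp_le_one_iff]
    nlinarith
  have h4 := Real.add_one_le_exp (-((r - s) * l))
  have h5 : 0 ≤ (r - s) * l := mul_nonneg (by linarith) hl
  rw [h2]
  nlinarith [Real.exp_pos (-(t - r) * l), Real.exp_pos (-((r - s) * l))]

/-- Sample the kernel at the right endpoints of `n + 1` cells of length `t / (n + 1)`. It is
`l`-Lipschitz on `(0, t]`, so the error is at most `h n * l` there and zero elsewhere. -/
lemma expKernel_mem_closure {l t : ℝ} (hl : 0 ≤ l) (ht : 0 ≤ t) :
    (memLp_expKernel l t).toLp _ ∈ closure (Set.range stepL2) := by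
  lift t to ℝ≥0 using ht
  let h (n : ℕ) : ℝ≥0 := t / (n + 1)
  let c (n : ℕ) : StepData := ∑ i ∈ Finset.range (n + 1),
    Finsupp.single ((i : ℝ≥0) * h n, h n) (Real.exp (-((t : ℝ) - ((i : ℝ) * h n + h n)) * l))
  have hn (n : ℕ) : ((n + 1 : ℕ) : ℝ) * h n = t := by
    simp [h]; field_simp
  have hc (n : ℕ) (s : ℝ) : (c n).toFun s = ∑ i ∈ Finset.range (n + 1),
      Real.exp (-((t : ℝ) - ((i : ℝ) * h n + h n)) * l) *
        (Set.Ioc (i * h n : ℝ) (i * h n + h n)).indicator (fun _ => (1 : ℝ)) s := by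
    simp only [c]
    generalize n + 1 = m
    induction m with
    | zero => simp [StepData.toFun]
    | succ m ih =>
      rw [Finset.sum_range_succ, Finset.sum_range_succ, StepData.toFun_add, Pi.add_apply, ih,
        StepData.toFun_single]
      simp
  have hb (n : ℕ) (s : ℝ) : ‖(c n).toFun s - expKernel l t s‖ ≤
      ‖(Set.Ioc (0 : ℝ) t).indicator (fun _ => (h n * l : ℝ)) s‖ := by
    have h1 : expKernel l t s = ∑ i ∈ Finset.range (n + 1),
        Real.exp (-((t : ℝ) - s) * l) *
        (Set.Ioc (i * h n : ℝ) (i * h n + h n)).indicator (fun _ => (1 : ℝ)) s := by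
      rw [← Finset.mul_sum, ← indicator_Ioc_eq_sum, hn, expKernel]
      simp [Set.indicator_apply]
    have h2 : (Set.Ioc (0 : ℝ) t).indicator (fun _ => (h n * l : ℝ)) s =
        ∑ i ∈ Finset.range (n + 1), h n * l *
        (Set.Ioc (i * h n : ℝ) (i * h n + h n)).indicator (fun _ => (1 : ℝ)) s := by
      rw [← Finset.mul_sum, ← indicator_Ioc_eq_sum, hn]
      simp [Set.indicator_apply]
    rw [hc, h1, ← Finset.sum_sub_distrib]
    refine le_trans ?_ (le_abs_self _)
    rw [h2]
    refine (norm_sum_le _ _).trans (Finset.sum_le_sum fun i hi => ?_)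
    rw [← sub_mul]
    by_cases hs : s ∈ Set.Ioc (i * h n : ℝ) (i * h n + h n)
    · rw [Set.indicator_of_mem hs, mul_one, mul_one, Real.norm_eq_abs]
      refine (abs_exp_kernel_sub_le hl hs.2 ?_).trans ?_
      · rw [← hn n]
        have : (i : ℝ) + 1 ≤ (n + 1 : ℕ) := by exact_mod_cast Finset.mem_range.1 hi
        nlinarith [(h n).coe_nonneg]
      · exact mul_le_mul_of_nonneg_right (by linarith [hs.1]) hl
    · simp [Set.indicator_of_notMem hs]
  refine mem_closure_of_tendsto (f := fun n => stepL2 (c n)) (b := atTop) ?_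
    (Eventually.of_forall fun n => ⟨c n, rfl⟩)
  let G : Lp ℝ 2 (volume : Measure ℝ) := indicatorConstLp 2
    (measurableSet_Ioc (a := (0 : ℝ)) (b := t)) measure_Ioc_lt_top.ne (1 : ℝ)
  have hle (n : ℕ) : ‖stepL2 (c n) - (memLp_expKernel l t).toLp _‖ ≤ h n * l * ‖G‖ := by
    refine Lp.norm_le_mul_norm_of_ae_le_mul ?_
    filter_upwards [coeFn_stepL2 (c n), (memLp_expKernel l t).coeFn_toLp,
      Lp.coeFn_sub (stepL2 (c n)) ((memLp_expKernel l t).toLp _),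
      indicatorConstLp_coeFn (p := 2) (hs := measurableSet_Ioc (a := (0 : ℝ)) (b := t))
        (hμs := measure_Ioc_lt_top.ne) (c := (1 : ℝ))] with s h1 h2 h3 h4
    rw [h3, Pi.sub_apply, h1, h2, h4]
    refine (hb n s).trans ?_
    have : 0 ≤ h n * l := mul_nonneg (h n).coe_nonneg hl
    by_cases hs : s ∈ Set.Ioc (0 : ℝ) t <;> simp [hs, abs_of_nonneg hl]
  rw [tendsto_iff_norm_sub_tendsto_zero]
  have hlim : Tendsto (fun n : ℕ => (h n : ℝ)) atTop (𝓝 0) := by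
    have : Tendsto (fun n : ℕ => (t : ℝ) * (1 / ((n : ℝ) + 1))) atTop (𝓝 ((t : ℝ) * 0)) :=
      tendsto_one_div_add_atTop_nhds_zero_nat.const_mul _
    simpa [h, div_eq_mul_inv] using this
  refine squeeze_zero (fun _ => norm_nonneg _) hle ?_
  simpa using (hlim.mul_const l).mul_const ‖G‖

lemma integral_expKernel_mul {l s t : ℝ} (hl : 0 < l) (hs : 0 ≤ s) (hst : s ≤ t) :
    ∫ r, expKernel l s r * expKernel l t r =
      (Real.exp (-((t - s) * l)) - Real.exp (-((t + s) * l))) / (2 * l) := by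
  have h1 : (fun r => expKernel l s r * expKernel l t r) =
      (Set.Ioc 0 s).indicator fun r => Real.exp (2 * l * r - (s + t) * l) := by
    ext r
    by_cases hr : r ∈ Set.Ioc 0 s
    · have hr' : r ∈ Set.Ioc 0 t := ⟨hr.1, hr.2.trans hst⟩
      rw [expKernel, expKernel, Set.indicator_of_mem hr, Set.indicator_of_mem hr',
        Set.indicator_of_mem hr, ← Real.exp_add]
      ring_nf
    · rw [expKernel, Set.indicator_of_notMem hr, Set.indicator_of_notMem hr, zero_mul]
  rw [h1, integral_indicator measurableSet_Ioc, ← intervalIntegral.integral_of_le hs]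
  have hd (r : ℝ) : HasDerivAt (fun r => Real.exp (2 * l * r - (s + t) * l) / (2 * l))
      (Real.exp (2 * l * r - (s + t) * l)) r := by
    have := ((((hasDerivAt_id r).const_mul (2 * l)).sub_const ((s + t) * l)).exp).div_const (2 * l)
    refine this.congr_deriv ?_
    simp only [id_eq]
    field_simp
  rw [intervalIntegral.integral_eq_sub_of_hasDerivAt (fun r _ => hd r)
    (Continuous.intervalIntegrable (by fun_prop) _ _), ← sub_div]
  ring_nf

section OrnsteinUhlenbeck

variable [IsProbabilityMeasure P] {l s t : ℝ}

lemma inner_wienerIntegral_expKernel (hB : IsPreBrownianReal B P) (hl : 0 < l) (hs : 0 ≤ s)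
    (hst : s ≤ t) :
    ⟪wienerIntegral B P (expKernel l s), wienerIntegral B P (expKernel l t)⟫ =
      (Real.exp (-((t - s) * l)) - Real.exp (-((t + s) * l))) / (2 * l) := by
  rw [inner_wienerIntegral hB (memLp_expKernel l s) (memLp_expKernel l t)
    (expKernel_mem_closure hl.le hs) (expKernel_mem_closure hl.le (hs.trans hst)),
    integral_expKernel_mul hl hs hst]

lemma norm_sq_wienerIntegral_expKernel_le (hB : IsPreBrownianReal B P) (hl : 0 < l) (ht : 0 ≤ t) :
    ‖wienerIntegral B P (expKernel l t)‖ ^ 2 ≤ 1 / l := by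
  rw [← real_inner_self_eq_norm_sq, inner_wienerIntegral_expKernel hB hl ht le_rfl, sub_self,
    zero_mul, neg_zero, Real.exp_zero, div_le_div_iff₀ (by positivity) hl]
  nlinarith [Real.exp_pos (-((t + t) * l))]

/-- The left side equals `(1 - e^(-(t-s)l)) / l - (e^(-tl) - e^(-sl))² / (2l)`. Drop the square and
use `1 - e^(-x) ≤ min 1 x`. -/
lemma norm_sq_wienerIntegral_expKernel_sub_le_of_le (hB : IsPreBrownianReal B P) (hl : 0 < l)
    (hs : 0 ≤ s) (hst : s ≤ t) :
    ‖wienerIntegral B P (expKernel l t) - wienerIntegral B P (expKernel l s)‖ ^ 2 ≤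
      min (1 / l) (t - s) := by
  rw [norm_sub_sq_real, real_inner_comm, ← real_inner_self_eq_norm_sq, ← real_inner_self_eq_norm_sq,
    inner_wienerIntegral_expKernel hB hl (hs.trans hst) le_rfl,
    inner_wienerIntegral_expKernel hB hl hs hst, inner_wienerIntegral_expKernel hB hl hs le_rfl]
  have h1 : Real.exp (-((t + t) * l)) = Real.exp (-(t * l)) ^ 2 := by
    rw [sq, ← Real.exp_add]; ring_nf
  have h2 : Real.exp (-((s + s) * l)) = Real.exp (-(s * l)) ^ 2 := by
    rw [sq, ← Real.exp_add]; ring_nf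
  have h3 : Real.exp (-((t + s) * l)) = Real.exp (-(t * l)) * Real.exp (-(s * l)) := by
    rw [← Real.exp_add]; ring_nf
  have h4 := Real.add_one_le_exp (-((t - s) * l))
  have h5 := Real.exp_pos (-((t - s) * l))
  have h6 : (1 - Real.exp (-((t - s) * l))) / l ≤ min (1 / l) (t - s) := by
    refine le_min (by gcongr; linarith) ?_
    rw [div_le_iff₀ hl]
    linarith
  refine le_trans (le_of_sub_nonneg ?_) h6
  rw [h1, h2, h3, sub_self, sub_self, zero_mul, neg_zero, Real.exp_zero]
  have : (1 - Real.exp (-((t - s) * l))) / l - ((1 - Real.exp (-(t * l)) ^ 2) / (2 * l) -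
      2 * ((Real.exp (-((t - s) * l)) - Real.exp (-(t * l)) * Real.exp (-(s * l))) / (2 * l)) +
      (1 - Real.exp (-(s * l)) ^ 2) / (2 * l)) =
      (Real.exp (-(t * l)) - Real.exp (-(s * l))) ^ 2 / (2 * l) := by
    field_simp
    ring
  rw [this]
  positivity

lemma norm_sq_wienerIntegral_expKernel_sub_le (hB : IsPreBrownianReal B P) (hl : 0 < l)
    (hs : 0 ≤ s) (ht : 0 ≤ t) :
    ‖wienerIntegral B P (expKernel l t) - wienerIntegral B P (expKernel l s)‖ ^ 2 ≤
      min (1 / l) |t - s| := by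
  rcases le_total s t with h | h
  · rw [abs_of_nonneg (sub_nonneg.2 h)]
    exact norm_sq_wienerIntegral_expKernel_sub_le_of_le hB hl hs h
  · rw [norm_sub_rev, abs_sub_comm, abs_of_nonneg (sub_nonneg.2 h)]
    exact norm_sq_wienerIntegral_expKernel_sub_le_of_le hB hl ht h

end OrnsteinUhlenbeck

end WienerIntegral

/-! ### Gaussian moments and orthogonality of the modes. -/

section GaussianSpace

variable {Ω : Type*} [MeasurableSpace Ω] {P : Measure Ω}

/-! ### Moments of Gaussian variables -/

/-- A centred Gaussian variable has the law of `‖X‖` times a standard one. -/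
lemma eLpNorm_of_hasGaussianLaw {X : Lp ℝ 2 P} (hX : HasGaussianLaw X P) (h0 : ∫ ω, X ω ∂P = 0)
    (q : ℝ≥0∞) : eLpNorm X q P = ‖X‖ₑ * eLpNorm id q (gaussianReal 0 1) := by
  have := hX.isProbabilityMeasure
  have hv : Var[X; P] = ‖X‖ ^ 2 := by
    rw [variance_of_integral_eq_zero hX.aemeasurable h0, ← real_inner_self_eq_norm_sq, L2.inner_def]
    simp [sq]
  have hmap : P.map X = (gaussianReal 0 1).map (fun x => ‖X‖ * x) := by
    rw [hX.map_eq_gaussianReal, h0, hv, gaussianReal_map_const_mul, mul_zero, mul_one]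
    congr 1
    ext
    simp
  calc eLpNorm X q P = eLpNorm id q (P.map X) :=
        (eLpNorm_map_measure aestronglyMeasurable_id hX.aemeasurable).symm
    _ = eLpNorm (fun x => ‖X‖ * x) q (gaussianReal 0 1) := by
        rw [hmap, eLpNorm_map_measure aestronglyMeasurable_id (by fun_prop)]
        rfl
    _ = ‖X‖ₑ * eLpNorm id q (gaussianReal 0 1) := by
        have := eLpNorm_const_smul ‖X‖ (id : ℝ → ℝ) q (gaussianReal 0 1)
        rw [enorm_norm] at this
        exact this

lemma hasGaussianLaw_integral {B : ℝ≥0 → Ω → ℝ} (hB : IsPreBrownianReal B P) (c : StepData) :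
    HasGaussianLaw (c.integral B) P := by
  have h : IsGaussianProcess (fun (q : ℝ≥0 × ℝ≥0) ω => B (q.1 + q.2) ω - B q.1 ω) P :=
    hB.isGaussianProcess.of_isGaussianProcess fun q => ⟨{q.1 + q.2, q.1},
      { toFun x := x ⟨q.1 + q.2, by simp⟩ - x ⟨q.1, by simp⟩
        map_add' x y := by simp; ring
        map_smul' r x := by simp; ring }, by simp⟩
  exact (h.smul c).hasGaussianLaw_fun_sum (I := c.support)

lemma integral_integral_eq_zero {B : ℝ≥0 → Ω → ℝ} (hB : IsPreBrownianReal B P) (c : StepData) :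
    ∫ ω, c.integral B ω ∂P = 0 := by
  have hi (q : ℝ≥0 × ℝ≥0) : Integrable (fun ω => c q * (B (q.1 + q.2) ω - B q.1 ω)) P :=
    ((hB.integrable_eval _).sub (hB.integrable_eval _)).const_mul _
  simp_rw [StepData.integral, Finsupp.sum]
  rw [integral_finsetSum _ fun q _ => hi q]
  refine Finset.sum_eq_zero fun q _ => ?_
  rw [integral_const_mul, integral_sub (hB.integrable_eval _) (hB.integrable_eval _),
    hB.integral_eval, hB.integral_eval, sub_zero, mul_zero]

lemma measurable_integral_eval (c : StepData) :
    Measurable (c.integral fun t (p : ℝ≥0 → ℝ) => p t) := by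
  unfold StepData.integral Finsupp.sum
  fun_prop

/-! ### The Gaussian space of a cylindrical Wiener process -/

/-- The closed subspace of `L²(Ω)` generated by the `k`-th Brownian motion. -/
def modeSpace (β : Mode → ℝ≥0 → Ω → ℝ) (P : Measure Ω) (k : Mode) : Submodule ℝ (Lp ℝ 2 P) :=
  (LinearMap.range (elemIntegral (β k) P)).topologicalClosure

/-- The closed subspace of `L²(Ω)` generated by all the Brownian motions. -/
def gaussSpace (β : Mode → ℝ≥0 → Ω → ℝ) (P : Measure Ω) : Submodule ℝ (Lp ℝ 2 P) :=
  (⨆ k, LinearMap.range (elemIntegral (β k) P)).topologicalClosure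

variable {β : Mode → ℝ≥0 → Ω → ℝ}

lemma modeSpace_le_gaussSpace (k : Mode) : modeSpace β P k ≤ gaussSpace β P :=
  Submodule.topologicalClosure_mono (le_iSup (fun k => LinearMap.range (elemIntegral (β k) P)) k)

/-- Elementary integrals of different modes are independent and centred, hence orthogonal;
orthogonality passes to closures. -/
lemma orthogonalFamily_modeSpace (hβ : IsCylindricalWiener β P) :
    OrthogonalFamily ℝ (fun k => modeSpace β P k) fun k => (modeSpace β P k).subtypeₗᵢ := by
  refine OrthogonalFamily.of_pairwise fun k l hkl => ?_
  have key : LinearMap.range (elemIntegral (β k) P) ⟂ LinearMap.range (elemIntegral (β l) P) := by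
    rw [Submodule.isOrtho_iff_inner_eq]
    rintro _ ⟨c, rfl⟩ _ ⟨d, rfl⟩
    have hk := (hβ.brownian k).toIsPreBrownianReal
    have hl := (hβ.brownian l).toIsPreBrownianReal
    have hind : IndepFun (c.integral (β k)) (d.integral (β l)) P :=
      (hβ.indep.indepFun hkl).comp (measurable_integral_eval c) (measurable_integral_eval d)
    rw [L2.inner_def]
    have : (fun ω => ⟪elemIntegral (β k) P c ω, elemIntegral (β l) P d ω⟫) =ᵐ[P]
        fun ω => c.integral (β k) ω * d.integral (β l) ω := by
      filter_upwards [coeFn_elemIntegral hk c, coeFn_elemIntegral hl d] with ω h1 h2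
      rw [h1, h2]
      simp [mul_comm]
    rw [integral_congr_ae this, hind.integral_fun_mul_eq_mul_integral
      (hasGaussianLaw_integral hk c).aemeasurable.aestronglyMeasurable
      (hasGaussianLaw_integral hl d).aemeasurable.aestronglyMeasurable,
      integral_integral_eq_zero hk, zero_mul]
  change (LinearMap.range _).topologicalClosure ⟂ (LinearMap.range _).topologicalClosure
  rw [Submodule.isOrtho_iff_le, Submodule.orthogonal_closure]
  refine Submodule.topologicalClosure_minimal _ (Submodule.isOrtho_iff_le.1 key)
    (Submodule.isClosed_orthogonal _)

lemma hasGaussianLaw_of_mem_iSup (hβ : IsCylindricalWiener β P) {X : Lp ℝ 2 P}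
    (hX : X ∈ ⨆ k, LinearMap.range (elemIntegral (β k) P)) :
    HasGaussianLaw X P ∧ ∫ ω, X ω ∂P = 0 := by
  obtain ⟨f, hf, rfl⟩ := (Submodule.mem_iSup_iff_exists_finsupp _ _).1 hX
  choose c hc using hf
  have hk (k) := (hβ.brownian k).toIsPreBrownianReal
  have hae : (f.sum fun _ Y => Y : Lp ℝ 2 P) =ᵐ[P]
      fun ω => ∑ k : f.support, (c k).integral (β k) ω := by
    have h1 : ∀ᵐ ω ∂P, ∀ k : f.support, f k ω = (c k).integral (β k) ω :=
      ae_all_iff.2 fun k => hc k ▸ coeFn_elemIntegral (hk k) (c k)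
    rw [Finsupp.sum]
    filter_upwards [h1, Lp.coeFn_finsetSum f.support f] with ω h2 h3
    rw [h3, Finset.sum_apply, ← Finset.sum_coe_sort]
    simp [h2]
  have hind : iIndepFun (fun (k : f.support) => (c k).integral (β k)) P :=
    (hβ.indep.comp _ fun k => measurable_integral_eval (c k)).precomp
      (g := fun k : f.support => (k : Mode)) Subtype.val_injective
  refine ⟨(iIndepFun.hasGaussianLaw_fun_sum (ι := f.support) (fun k =>
    hasGaussianLaw_integral (hk k) (c k)) hind).congr
    hae.symm, ?_⟩
  rw [integral_congr_ae hae, integral_finsetSum _ fun (k : f.support) _ =>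
    (hasGaussianLaw_integral (hk k) (c k)).integrable]
  exact Finset.sum_eq_zero fun k _ => integral_integral_eq_zero (hk k) (c k)

/-- For `q > 2`, convergence in `L²` does not by itself give convergence in `L^q`; convergence in
measure and lower semicontinuity of the `L^q` norm suffice for the inequality. -/
lemma eLpNorm_le_of_mem_gaussSpace (hβ : IsCylindricalWiener β P) {X : Lp ℝ 2 P}
    (hX : X ∈ gaussSpace β P) {q : ℝ≥0∞} (hq : q ≠ ∞) :
    eLpNorm X q P ≤ ‖X‖ₑ * eLpNorm id q (gaussianReal 0 1) := by
  obtain ⟨x, hx, hxX⟩ := mem_closure_iff_seq_limit.1 hX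
  have hA : eLpNorm id q (gaussianReal 0 1) ≠ ∞ := (memLp_id_gaussianReal' q hq).eLpNorm_ne_top
  have hlim : Tendsto (fun n => eLpNorm (x n) q P) atTop
      (𝓝 (‖X‖ₑ * eLpNorm id q (gaussianReal 0 1))) := by
    refine (ENNReal.Tendsto.mul_const hxX.enorm (Or.inr hA)).congr fun n => ?_
    have := hasGaussianLaw_of_mem_iSup hβ (hx n)
    exact (eLpNorm_of_hasGaussianLaw this.1 this.2 q).symm
  refine le_of_forall_gt_imp_ge_of_dense fun C hC => ?_
  exact eLpNorm_le_of_tendstoInMeasure (hlim.eventually_le_const hC)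
    (tendstoInMeasure_of_tendsto_Lp hxX) fun n => Lp.aestronglyMeasurable _

end GaussianSpace

/-! ### Second moments of the field and of its increments. -/

section RandomField

/-! ### The Fourier modes -/

/-- Pythagoras bounds every finite partial sum by `∑' i, b i`, and the bound survives the limit. -/
lemma summable_and_norm_sq_tsum_le {ι E : Type*} [NormedAddCommGroup E] [InnerProductSpace ℝ E]
    [CompleteSpace E] {V : ι → Submodule ℝ E}
    (hV : OrthogonalFamily ℝ (fun i => V i) fun i => (V i).subtypeₗᵢ) {v : ι → E}
    (hv : ∀ i, v i ∈ V i) {b : ι → ℝ} (hb : Summable b) (hvb : ∀ i, ‖v i‖ ^ 2 ≤ b i) :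
    Summable v ∧ ‖∑' i, v i‖ ^ 2 ≤ ∑' i, b i := by
  have hs : Summable v := (hV.summable_iff_norm_sq_summable fun i => ⟨v i, hv i⟩).2
    (Summable.of_nonneg_of_le (fun _ => sq_nonneg _) hvb hb)
  refine ⟨hs, le_of_tendsto (hs.hasSum.norm.pow 2) (Eventually.of_forall fun s => ?_)⟩
  have h := hV.norm_sum (fun i => ⟨v i, hv i⟩) s
  simp only [Submodule.coe_subtypeₗᵢ, Submodule.subtype_apply, Submodule.coe_norm] at h
  rw [h]
  exact (Finset.sum_le_sum fun i _ => hvb i).trans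
    (hb.sum_le_tsum _ fun i _ => (sq_nonneg _).trans (hvb i))

lemma Mode.one_le_len (k : Mode) : 1 ≤ k.len := by
  rw [Mode.len, Real.one_le_sqrt]
  have h : k.1.1 ≠ 0 ∨ k.1.2 ≠ 0 := by
    by_contra! h
    exact k.2 (Prod.ext h.1 h.2)
  have : 1 ≤ k.1.1 ^ 2 + k.1.2 ^ 2 := by
    rcases h with h | h <;> have := sq_pos_of_ne_zero h <;>
      nlinarith [sq_nonneg k.1.1, sq_nonneg k.1.2]
  exact_mod_cast this

lemma Mode.abs_fst_le_len (k : Mode) : |(k.1.1 : ℝ)| ≤ k.len :=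
  Real.abs_le_sqrt (by nlinarith [sq_nonneg (k.1.2 : ℝ)])

lemma Mode.abs_snd_le_len (k : Mode) : |(k.1.2 : ℝ)| ≤ k.len :=
  Real.abs_le_sqrt (by nlinarith [sq_nonneg (k.1.1 : ℝ)])

lemma summable_inv_len_pow_three : Summable fun k : Mode => (k.len ^ 3)⁻¹ := by
  have h := EisensteinSeries.summable_one_div_norm_rpow (k := 3) (by norm_num)
  have hinj : Function.Injective fun k : Mode => (![k.1.1, k.1.2] : Fin 2 → ℤ) := by
    intro k l hkl
    have h0 := congrFun hkl 0
    have h1 := congrFun hkl 1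
    exact Subtype.ext (Prod.ext h0 h1)
  refine Summable.of_nonneg_of_le (fun k => by have := k.one_le_len; positivity) (fun k => ?_)
    (h.comp_injective hinj)
  have hle : ‖(![k.1.1, k.1.2] : Fin 2 → ℤ)‖ ≤ k.len := by
    rw [pi_norm_le_iff_of_nonneg (zero_le_one.trans k.one_le_len)]
    intro i
    fin_cases i
    · simpa [Int.norm_eq_abs] using k.abs_fst_le_len
    · simpa [Int.norm_eq_abs] using k.abs_snd_le_len
  have hpos : 0 < ‖(![k.1.1, k.1.2] : Fin 2 → ℤ)‖ := by
    rw [norm_pos_iff]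
    intro h0
    exact k.2 (Prod.ext (congrFun h0 0) (congrFun h0 1))
  rw [Function.comp_apply, Real.rpow_neg hpos.le]
  norm_cast
  gcongr

lemma abs_trigBasis_le {L : ℝ} (hL : 0 < L) (n : ℤ) (z : ℝ) :
    |trigBasis L n z| ≤ Real.sqrt (2 / L) := by
  have h : 0 ≤ Real.sqrt (2 / L) := Real.sqrt_nonneg _
  unfold trigBasis
  split_ifs
  · rw [abs_mul, abs_of_nonneg h]
    exact mul_le_of_le_one_right h (Real.abs_sin_le_one _)
  · rw [one_div, ← Real.sqrt_inv, abs_of_nonneg (Real.sqrt_nonneg _), ← one_div]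
    gcongr
    norm_num
  · rw [abs_mul, abs_of_nonneg h]
    exact mul_le_of_le_one_right h (Real.abs_cos_le_one _)

lemma abs_trigBasis_sub_le {L : ℝ} (hL : 0 < L) (n : ℤ) (z y : ℝ) :
    |trigBasis L n z - trigBasis L n y| ≤
      Real.sqrt (2 / L) * (2 * Real.pi / L * |(n : ℝ)| * |z - y|) := by
  have h : 0 ≤ Real.sqrt (2 / L) := Real.sqrt_nonneg _
  have key : |2 * Real.pi * n / L * z - 2 * Real.pi * n / L * y| =
      2 * Real.pi / L * |(n : ℝ)| * |z - y| := by
    rw [← mul_sub, abs_mul, abs_div, abs_mul, abs_of_pos hL, abs_of_pos Real.two_pi_pos]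
    ring
  unfold trigBasis
  split_ifs
  · rw [← mul_sub, abs_mul, abs_of_nonneg h, ← key]
    exact mul_le_mul_of_nonneg_left (Real.abs_sin_sub_sin_le _ _) h
  · rw [sub_self, abs_zero]
    have := Real.pi_pos
    positivity
  · rw [← mul_sub, abs_mul, abs_of_nonneg h, ← key]
    exact mul_le_mul_of_nonneg_left (Real.abs_cos_sub_cos_le _ _) h

lemma abs_eigenfun_le {L : ℝ} (hL : 0 < L) (k : Mode) (x : ℝ × ℝ) : |eigenfun L k x| ≤ 2 / L := by
  rw [eigenfun, abs_mul, ← Real.mul_self_sqrt (by positivity : 0 ≤ 2 / L)]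
  gcongr <;> exact abs_trigBasis_le hL _ _

lemma abs_eigenfun_sub_le {L : ℝ} (hL : 0 < L) (k : Mode) (x y : ℝ × ℝ) :
    |eigenfun L k x - eigenfun L k y| ≤ 4 / L * (2 * Real.pi / L * k.len) * dist x y := by
  have h : 0 ≤ Real.sqrt (2 / L) := Real.sqrt_nonneg _
  have hs := Real.mul_self_sqrt (by positivity : 0 ≤ 2 / L)
  have hπ := Real.pi_pos
  have hlen := k.one_le_len
  have h1 : |trigBasis L k.1.1 x.1 - trigBasis L k.1.1 y.1| ≤
      Real.sqrt (2 / L) * (2 * Real.pi / L * k.len * dist x y) := by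
    refine (abs_trigBasis_sub_le hL _ _ _).trans ?_
    gcongr
    · exact k.abs_fst_le_len
    · exact le_max_left _ _
  have h2 : |trigBasis L k.1.2 x.2 - trigBasis L k.1.2 y.2| ≤
      Real.sqrt (2 / L) * (2 * Real.pi / L * k.len * dist x y) := by
    refine (abs_trigBasis_sub_le hL _ _ _).trans ?_
    gcongr
    · exact k.abs_snd_le_len
    · exact le_max_right _ _
  calc |eigenfun L k x - eigenfun L k y|
      = |(trigBasis L k.1.1 x.1 - trigBasis L k.1.1 y.1) * trigBasis L k.1.2 x.2 +
          trigBasis L k.1.1 y.1 * (trigBasis L k.1.2 x.2 - trigBasis L k.1.2 y.2)| := by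
        rw [eigenfun, eigenfun]; ring_nf
    _ ≤ |trigBasis L k.1.1 x.1 - trigBasis L k.1.1 y.1| * |trigBasis L k.1.2 x.2| +
          |trigBasis L k.1.1 y.1| * |trigBasis L k.1.2 x.2 - trigBasis L k.1.2 y.2| := by
        rw [← abs_mul, ← abs_mul]; exact abs_add_le _ _
    _ ≤ Real.sqrt (2 / L) * (2 * Real.pi / L * k.len * dist x y) * Real.sqrt (2 / L) +
          Real.sqrt (2 / L) * (Real.sqrt (2 / L) * (2 * Real.pi / L * k.len * dist x y)) := by
        gcongr <;> exact abs_trigBasis_le hL _ _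
    _ = 2 * (Real.sqrt (2 / L) * Real.sqrt (2 / L)) * (2 * Real.pi / L * k.len * dist x y) := by
        ring
    _ = 4 / L * (2 * Real.pi / L * k.len) * dist x y := by
        rw [hs]; ring

/-! ### The random field -/

variable {Ω : Type*} [MeasurableSpace Ω] {P : Measure Ω} [IsProbabilityMeasure P]
  {β : Mode → ℝ≥0 → Ω → ℝ} {L t s : ℝ}

lemma eigenval_sq (L : ℝ) (k : Mode) : eigenval L k ^ 2 = (2 * Real.pi / L * k.len) ^ 4 := by
  rw [eigenval]; ring

lemma norm_sq_convCoeff_le (hβ : IsCylindricalWiener β P) (hL : 0 < L) (k : Mode) (ht : 0 ≤ t) :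
    ‖convCoeff L β P k t‖ ^ 2 ≤ ((2 * Real.pi / L * k.len)⁻¹) ^ 4 := by
  have hpos : 0 < 2 * Real.pi / L * k.len := by
    have := k.one_le_len; have := Real.pi_pos; positivity
  rw [inv_pow, ← eigenval_sq, ← one_div]
  exact norm_sq_wienerIntegral_expKernel_le (hβ.brownian k).toIsPreBrownianReal
    (by rw [eigenval_sq]; positivity) ht

lemma norm_sq_convCoeff_sub_le (hβ : IsCylindricalWiener β P) (hL : 0 < L) (k : Mode) (ht : 0 ≤ t)
    (hs : 0 ≤ s) :
    ‖convCoeff L β P k t - convCoeff L β P k s‖ ^ 2 ≤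
      min (((2 * Real.pi / L * k.len)⁻¹) ^ 4) |t - s| := by
  have hpos : 0 < 2 * Real.pi / L * k.len := by
    have := k.one_le_len; have := Real.pi_pos; positivity
  rw [inv_pow, ← eigenval_sq, ← one_div]
  exact norm_sq_wienerIntegral_expKernel_sub_le (hβ.brownian k).toIsPreBrownianReal
    (by rw [eigenval_sq]; positivity) hs ht

lemma convCoeff_mem_modeSpace (hβ : IsCylindricalWiener β P) (k : Mode) (ht : 0 ≤ t) :
    convCoeff L β P k t ∈ modeSpace β P k :=
  wienerIntegral_mem_closure (hβ.brownian k).toIsPreBrownianReal (memLp_expKernel _ _)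
    (expKernel_mem_closure (sq_nonneg _) ht)

lemma convTerm_mem_modeSpace (hβ : IsCylindricalWiener β P) (a : Mode → ℝ) (ht : 0 ≤ t)
    (x : ℝ × ℝ) (k : Mode) : convTerm L β P a t x k ∈ modeSpace β P k :=
  (modeSpace β P k).smul_mem _ (convCoeff_mem_modeSpace hβ k ht)

/-- With `m` of order `1 / |k|` and `g` a fourth root of the distance, this keeps three powers of
decay for the sum over modes and spends the fourth on Hölder regularity. -/
lemma min_pow_four_le {m g : ℝ} (hm : 0 ≤ m) (hg : 0 ≤ g) : min (m ^ 4) (g ^ 4) ≤ m ^ 3 * g := by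
  rcases le_total m g with h | h
  · exact (min_le_left _ _).trans (by rw [pow_succ]; gcongr)
  · refine (min_le_right _ _).trans ?_
    rw [pow_succ]
    gcongr

lemma norm_sq_convTerm_le (hβ : IsCylindricalWiener β P) (hL : 0 < L) (a : Mode → ℝ) (ht : 0 ≤ t)
    (x : ℝ × ℝ) (k : Mode) :
    ‖convTerm L β P a t x k‖ ^ 2 ≤
      4 / L ^ 2 * (L / (2 * Real.pi)) ^ 4 * (a k ^ 2 * (k.len ^ 3)⁻¹) := by
  have hlen := k.one_le_len
  have hπ := Real.pi_pos
  rw [convTerm, norm_smul, mul_pow, Real.norm_eq_abs, sq_abs, mul_pow, ← sq_abs (eigenfun L k x)]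
  calc a k ^ 2 * |eigenfun L k x| ^ 2 * ‖convCoeff L β P k t‖ ^ 2
      ≤ a k ^ 2 * (2 / L) ^ 2 * ((2 * Real.pi / L * k.len)⁻¹) ^ 4 := by
        gcongr
        · exact abs_eigenfun_le hL k x
        · exact norm_sq_convCoeff_le hβ hL k ht
    _ = 4 / L ^ 2 * (L / (2 * Real.pi)) ^ 4 * (a k ^ 2 * (k.len ^ 4)⁻¹) := by
        field_simp
        ring
    _ ≤ _ := by
        gcongr
        norm_num

/-- In the application `g` is the fourth root of the space-time distance. The bound `G` absorbs the
surplus `g ^ 3` of the spatial part, so that both parts are of order `m ^ 3 * g`. -/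
lemma norm_sq_convTerm_sub_le (hβ : IsCylindricalWiener β P) (hL : 0 < L) (a : Mode → ℝ)
    (ht : 0 ≤ t) (hs : 0 ≤ s) (x y : ℝ × ℝ) (k : Mode) {g G : ℝ} (hg : 0 ≤ g) (hgG : g ≤ G)
    (hts : |t - s| ≤ g ^ 4) (hxy : dist x y ≤ g ^ 4) :
    ‖convTerm L β P a t x k - convTerm L β P a s y k‖ ^ 2 ≤
      (8 + 32 * G ^ 3) / L ^ 2 * (L / (2 * Real.pi)) ^ 3 * (a k ^ 2 * (k.len ^ 3)⁻¹) * g := by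
  have hlen := k.one_le_len
  have hπ := Real.pi_pos
  have hr : 0 < 2 * Real.pi / L * k.len := by positivity
  set m := (2 * Real.pi / L * k.len)⁻¹ with hm
  have hm0 : 0 < m := inv_pos.2 hr
  have hZ : ‖convCoeff L β P k t - convCoeff L β P k s‖ ^ 2 ≤ m ^ 3 * g :=
    (norm_sq_convCoeff_sub_le hβ hL k ht hs).trans
      ((min_le_min_left _ hts).trans (min_pow_four_le hm0.le hg))
  have he : |eigenfun L k x - eigenfun L k y| ^ 2 * ‖convCoeff L β P k s‖ ^ 2 ≤
      16 / L ^ 2 * G ^ 3 * (m ^ 3 * g) := by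
    have h1 : |eigenfun L k x - eigenfun L k y| ≤ 4 / L := by
      refine (abs_sub _ _).trans ?_
      linarith [abs_eigenfun_le hL k x, abs_eigenfun_le hL k y, show 4 / L = 2 / L + 2 / L by ring]
    have h2 : |eigenfun L k x - eigenfun L k y| ≤ 4 / L * m⁻¹ * g ^ 4 := by
      rw [hm, inv_inv]
      refine (abs_eigenfun_sub_le hL k x y).trans ?_
      gcongr
    calc |eigenfun L k x - eigenfun L k y| ^ 2 * ‖convCoeff L β P k s‖ ^ 2
        ≤ (4 / L) * (4 / L * m⁻¹ * g ^ 4) * m ^ 4 := by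
          -- One factor takes the trivial bound, the other the Lipschitz bound: only one power of
          -- `m` is lost.
          rw [sq |_|]
          gcongr
          exact norm_sq_convCoeff_le hβ hL k hs
      _ = 16 / L ^ 2 * g ^ 3 * (m ^ 3 * g) := by
          field_simp
          ring
      _ ≤ _ := by gcongr
  have hsplit : convTerm L β P a t x k - convTerm L β P a s y k =
      (a k * eigenfun L k x) • (convCoeff L β P k t - convCoeff L β P k s) +
        (a k * (eigenfun L k x - eigenfun L k y)) • convCoeff L β P k s := by
    rw [convTerm, convTerm]
    module
  calc ‖convTerm L β P a t x k - convTerm L β P a s y k‖ ^ 2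
      ≤ (‖(a k * eigenfun L k x) • (convCoeff L β P k t - convCoeff L β P k s)‖ +
        ‖(a k * (eigenfun L k x - eigenfun L k y)) • convCoeff L β P k s‖) ^ 2 := by
        rw [hsplit]; gcongr; exact norm_add_le _ _
    _ ≤ 2 * (‖(a k * eigenfun L k x) • (convCoeff L β P k t - convCoeff L β P k s)‖ ^ 2 +
        ‖(a k * (eigenfun L k x - eigenfun L k y)) • convCoeff L β P k s‖ ^ 2) := add_sq_le
    _ = 2 * a k ^ 2 * (|eigenfun L k x| ^ 2 * ‖convCoeff L β P k t - convCoeff L β P k s‖ ^ 2 +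
        |eigenfun L k x - eigenfun L k y| ^ 2 * ‖convCoeff L β P k s‖ ^ 2) := by
        rw [norm_smul, norm_smul, Real.norm_eq_abs, Real.norm_eq_abs, abs_mul, abs_mul,
          ← sq_abs (a k)]
        ring
    _ ≤ 2 * a k ^ 2 * ((2 / L) ^ 2 * (m ^ 3 * g) + 16 / L ^ 2 * G ^ 3 * (m ^ 3 * g)) := by
        gcongr
        exact abs_eigenfun_le hL k x
    _ = _ := by
        rw [hm]
        field_simp
        ring

lemma summable_mul_inv_len {a : Mode → ℝ} {M : ℝ} (ha : ∀ k, |a k| ≤ M) :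
    Summable fun k : Mode => a k ^ 2 * (k.len ^ 3)⁻¹ := by
  refine Summable.of_nonneg_of_le (fun k => ?_) (fun k => ?_)
    (summable_inv_len_pow_three.mul_left (M ^ 2))
  · have := k.one_le_len
    positivity
  · have := k.one_le_len
    exact mul_le_mul_of_nonneg_right (sq_le_sq' (abs_le.1 (ha k)).1 (abs_le.1 (ha k)).2)
      (by positivity)

lemma summable_convTerm (hβ : IsCylindricalWiener β P) (hL : 0 < L) {a : Mode → ℝ} {M : ℝ}
    (ha : ∀ k, |a k| ≤ M) (ht : 0 ≤ t) (x : ℝ × ℝ) : Summable (convTerm L β P a t x) :=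
  (summable_and_norm_sq_tsum_le (orthogonalFamily_modeSpace hβ) (convTerm_mem_modeSpace hβ a ht x)
    ((summable_mul_inv_len ha).mul_left _) (norm_sq_convTerm_le hβ hL a ht x)).1

lemma norm_sq_stochConv_le (hβ : IsCylindricalWiener β P) (hL : 0 < L) {a : Mode → ℝ} {M : ℝ}
    (ha : ∀ k, |a k| ≤ M) (ht : 0 ≤ t) (x : ℝ × ℝ) :
    ‖stochConv L β P a t x‖ ^ 2 ≤
      4 / L ^ 2 * (L / (2 * Real.pi)) ^ 4 * ∑' k : Mode, a k ^ 2 * (k.len ^ 3)⁻¹ := by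
  rw [← tsum_mul_left]
  exact (summable_and_norm_sq_tsum_le (orthogonalFamily_modeSpace hβ)
    (convTerm_mem_modeSpace hβ a ht x)
    ((summable_mul_inv_len ha).mul_left _) (norm_sq_convTerm_le hβ hL a ht x)).2

lemma norm_sq_stochConv_sub_le (hβ : IsCylindricalWiener β P) (hL : 0 < L) {a : Mode → ℝ} {M : ℝ}
    (ha : ∀ k, |a k| ≤ M) (ht : 0 ≤ t) (hs : 0 ≤ s) (x y : ℝ × ℝ) {g G : ℝ} (hg : 0 ≤ g)
    (hgG : g ≤ G) (hts : |t - s| ≤ g ^ 4) (hxy : dist x y ≤ g ^ 4) :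
    ‖stochConv L β P a t x - stochConv L β P a s y‖ ^ 2 ≤
      (8 + 32 * G ^ 3) / L ^ 2 * (L / (2 * Real.pi)) ^ 3 *
        (∑' k : Mode, a k ^ 2 * (k.len ^ 3)⁻¹) * g := by
  rw [stochConv, stochConv, ← (summable_convTerm hβ hL ha ht x).tsum_sub
    (summable_convTerm hβ hL ha hs y), ← tsum_mul_left, ← tsum_mul_right]
  exact (summable_and_norm_sq_tsum_le (orthogonalFamily_modeSpace hβ)
    (fun k => (modeSpace β P k).sub_mem (convTerm_mem_modeSpace hβ a ht x k)
      (convTerm_mem_modeSpace hβ a hs y k))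
    (((summable_mul_inv_len ha).mul_left _).mul_right g)
    (fun k => norm_sq_convTerm_sub_le hβ hL a ht hs x y k hg hgG hts hxy)).2

lemma stochConv_mem_gaussSpace (hβ : IsCylindricalWiener β P) (hL : 0 < L) {a : Mode → ℝ} {M : ℝ}
    (ha : ∀ k, |a k| ≤ M) (ht : 0 ≤ t) (x : ℝ × ℝ) : stochConv L β P a t x ∈ gaussSpace β P := by
  refine (Submodule.isClosed_topologicalClosure _).mem_of_tendsto
    (summable_convTerm hβ hL ha ht x).hasSum (Eventually.of_forall fun s => ?_)
  exact (gaussSpace β P).sum_mem fun k _ =>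
    modeSpace_le_gaussSpace k (convTerm_mem_modeSpace hβ a ht x k)

lemma stochConv_sub (hβ : IsCylindricalWiener β P) (hL : 0 < L) {a b : Mode → ℝ} {M N : ℝ}
    (ha : ∀ k, |a k| ≤ M) (hb : ∀ k, |b k| ≤ N) (ht : 0 ≤ t) (x : ℝ × ℝ) :
    stochConv L β P (a - b) t x = stochConv L β P a t x - stochConv L β P b t x := by
  rw [stochConv, stochConv, stochConv, ← (summable_convTerm hβ hL ha ht x).tsum_sub
    (summable_convTerm hβ hL hb ht x)]
  congr with k
  rw [convTerm, convTerm, convTerm, ← sub_smul, Pi.sub_apply, sub_mul]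

end RandomField

/-! ### Kolmogorov-Chentsov in `L^q(Ω, C(D))`. -/

section KolmogorovChentsov

/-! ### Continuous versions of random fields -/

/-- Normalized tent functions of radius `r` around the net points. -/
lemma exists_partition_of_net {D ι : Type*} [PseudoMetricSpace D] [Fintype ι] (p : ι → D) {r : ℝ}
    (h : ∀ z, ∃ i, dist z (p i) < r) :
    ∃ φ : ι → C(D, ℝ), (∀ i z, 0 ≤ φ i z) ∧ (∀ z, ∑ i, φ i z = 1) ∧
      ∀ i z, φ i z ≠ 0 → dist z (p i) < r := by
  let u (i : ι) (z : D) : ℝ := max 0 (r - dist z (p i))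
  have hu (i z) : 0 ≤ u i z := le_max_left _ _
  have hpos (z : D) : 0 < ∑ i, u i z := by
    obtain ⟨i, hi⟩ := h z
    exact Finset.sum_pos' (fun i _ => hu i z) ⟨i, Finset.mem_univ i, lt_max_of_lt_right (by linarith)⟩
  refine ⟨fun i => ⟨fun z => u i z / ∑ j, u j z, ?_⟩, fun i z => ?_, fun z => ?_, fun i z hz => ?_⟩
  · exact Continuous.div (by fun_prop) (by fun_prop) fun z => (hpos z).ne'
  · exact div_nonneg (hu i z) (hpos z).le
  · simp only [ContinuousMap.coe_mk]
    rw [← Finset.sum_div, div_self (hpos z).ne']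
  · by_contra! hr
    refine hz ?_
    have : u i z = 0 := max_eq_left (by linarith)
    simp [this]

/-- At each point both sums are averages with the same weights `φ i z * ψ j z`, so their difference
averages the `x i - y j` over overlapping supports. -/
lemma norm_sum_smul_sub_sum_smul_le {D ι κ : Type*} [TopologicalSpace D] [CompactSpace D]
    [Fintype ι] [Fintype κ] {φ : ι → C(D, ℝ)} {ψ : κ → C(D, ℝ)} (hφ : ∀ i z, 0 ≤ φ i z)
    (hφ1 : ∀ z, ∑ i, φ i z = 1) (hψ : ∀ i z, 0 ≤ ψ i z) (hψ1 : ∀ z, ∑ i, ψ i z = 1)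
    {x : ι → ℝ} {y : κ → ℝ} {M : ℝ} (hM : 0 ≤ M)
    (h : ∀ i j z, φ i z ≠ 0 → ψ j z ≠ 0 → ‖x i - y j‖ ≤ M) :
    ‖∑ i, x i • φ i - ∑ j, y j • ψ j‖ ≤ M := by
  rw [ContinuousMap.norm_le _ hM]
  intro z
  have h1 : ∑ i, x i * φ i z = ∑ i, ∑ j, φ i z * ψ j z * x i := by
    refine Finset.sum_congr rfl fun i _ => ?_
    rw [← Finset.sum_mul, ← Finset.mul_sum, hψ1, mul_one, mul_comm]
  have h2 : ∑ j, y j * ψ j z = ∑ i, ∑ j, φ i z * ψ j z * y j := by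
    rw [Finset.sum_comm]
    refine Finset.sum_congr rfl fun j _ => ?_
    rw [← Finset.sum_mul, ← Finset.sum_mul, hφ1, one_mul, mul_comm]
  have h3 : ∑ i, ∑ j, φ i z * ψ j z * M = M := by
    simp_rw [← Finset.sum_mul, ← Finset.mul_sum, hψ1, mul_one, hφ1, one_mul]
  simp only [ContinuousMap.coe_sub, ContinuousMap.coe_sum, ContinuousMap.coe_smul, Pi.sub_apply,
    Finset.sum_apply, Pi.smul_apply, smul_eq_mul]
  rw [h1, h2, ← Finset.sum_sub_distrib, ← h3]
  refine (norm_sum_le _ _).trans (Finset.sum_le_sum fun i _ => ?_)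
  rw [← Finset.sum_sub_distrib]
  refine (norm_sum_le _ _).trans (Finset.sum_le_sum fun j _ => ?_)
  rw [← mul_sub, norm_mul, Real.norm_of_nonneg (mul_nonneg (hφ i z) (hψ j z))]
  by_cases hi : φ i z = 0
  · simp [hi]
  by_cases hj : ψ j z = 0
  · simp [hj]
  exact mul_le_mul_of_nonneg_left (h i j z hi hj) (mul_nonneg (hφ i z) (hψ j z))

variable {Ω : Type*} [MeasurableSpace Ω] {P : Measure Ω}

/-- The hypothesis `h` encodes that `‖f ω‖` is at most the maximum of the `‖g i ω‖` (zero for empty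
`s`). The `q`-th power of a maximum is at most the sum of the `q`-th powers, whence the factor `card
^ (1 / q)`. -/
lemma Lp.norm_le_card_rpow_mul {E ι : Type*} [NormedAddCommGroup E] {q : ℝ≥0∞} [Fact (1 ≤ q)]
    (hq : q ≠ ∞) (s : Finset ι) (f : Lp E q P) (g : ι → Lp ℝ q P) {c : ℝ} (hc : 0 ≤ c)
    (hg : ∀ i ∈ s, ‖g i‖ ≤ c)
    (h : ∀ᵐ ω ∂P, ∀ M : ℝ, 0 ≤ M → (∀ i ∈ s, ‖g i ω‖ ≤ M) → ‖f ω‖ ≤ M) :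
    ‖f‖ ≤ (s.card : ℝ) ^ (1 / q.toReal) * c := by
  have hq0 : q ≠ 0 := (zero_lt_one.trans_le Fact.out).ne'
  have hqp : 0 < q.toReal := ENNReal.toReal_pos hq0 hq
  have hpow (X : Lp ℝ q P) : ∫⁻ ω, ‖X ω‖ₑ ^ q.toReal ∂P = ‖X‖ₑ ^ q.toReal := by
    rw [Lp.enorm_def, eLpNorm_eq_lintegral_rpow_enorm_toReal hq0 hq, ← ENNReal.rpow_mul,
      one_div_mul_cancel hqp.ne', ENNReal.rpow_one]
  have hle : ‖f‖ₑ ^ q.toReal ≤ (s.card : ℝ≥0∞) * ENNReal.ofReal c ^ q.toReal := by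
    rw [Lp.enorm_def, eLpNorm_eq_lintegral_rpow_enorm_toReal hq0 hq, ← ENNReal.rpow_mul,
      one_div_mul_cancel hqp.ne', ENNReal.rpow_one]
    calc ∫⁻ ω, ‖f ω‖ₑ ^ q.toReal ∂P ≤ ∫⁻ ω, ∑ i ∈ s, ‖g i ω‖ₑ ^ q.toReal ∂P := by
          refine lintegral_mono_ae ?_
          filter_upwards [h] with ω hω
          set S := ∑ i ∈ s, ‖g i ω‖ₑ ^ q.toReal with hS
          have hSt : S ≠ ∞ := by
            rw [hS, ENNReal.sum_ne_top]
            exact fun i _ => ENNReal.rpow_ne_top_of_nonneg hqp.le enorm_ne_top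
          have hS1 : S ^ (1 / q.toReal) ≠ ∞ :=
            ENNReal.rpow_ne_top_of_nonneg (by positivity) hSt
          have h1 := hω (S ^ (1 / q.toReal)).toReal ENNReal.toReal_nonneg fun i hi => by
            rw [← toReal_enorm]
            refine ENNReal.toReal_mono hS1 ?_
            rw [one_div, ENNReal.le_rpow_inv_iff hqp, hS]
            exact Finset.single_le_sum (f := fun i => ‖g i ω‖ₑ ^ q.toReal) (fun _ _ => zero_le) hi
          rw [← toReal_enorm, ENNReal.toReal_le_toReal enorm_ne_top hS1,
            one_div, ENNReal.le_rpow_inv_iff hqp] at h1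
          exact h1
      _ = ∑ i ∈ s, ‖g i‖ₑ ^ q.toReal := by
          rw [lintegral_finsetSum' _ fun i _ =>
            (Lp.aestronglyMeasurable (g i)).enorm.pow_const _]
          exact Finset.sum_congr rfl fun i _ => hpow (g i)
      _ ≤ ∑ i ∈ s, ENNReal.ofReal c ^ q.toReal := by
          refine Finset.sum_le_sum fun i hi => ?_
          gcongr
          rw [← ofReal_norm]
          exact ENNReal.ofReal_le_ofReal (hg i hi)
      _ = (s.card : ℝ≥0∞) * ENNReal.ofReal c ^ q.toReal := by
          rw [Finset.sum_const, nsmul_eq_mul]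
  rw [← ofReal_norm, ENNReal.ofReal_rpow_of_nonneg (norm_nonneg _) hqp.le,
    ENNReal.ofReal_rpow_of_nonneg hc hqp.le, ← ENNReal.ofReal_natCast,
    ← ENNReal.ofReal_mul (by positivity), ENNReal.ofReal_le_ofReal_iff (by positivity)] at hle
  have := Real.rpow_le_rpow (by positivity) hle (one_div_nonneg.2 hqp.le)
  rwa [Real.mul_rpow (by positivity) (by positivity), ← Real.rpow_mul (norm_nonneg _),
    ← Real.rpow_mul hc, mul_one_div_cancel hqp.ne', Real.rpow_one, Real.rpow_one] at this

/-- The random continuous function `∑ i, X i • φ i`. -/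
def interpolate {D ι : Type*} [TopologicalSpace D] [CompactSpace D] [Fintype ι] {q : ℝ≥0∞}
    [Fact (1 ≤ q)] (X : ι → Lp ℝ q P) (φ : ι → C(D, ℝ)) : Lp C(D, ℝ) q P :=
  ∑ i, (ContinuousLinearMap.toSpanSingleton ℝ (φ i)).compLp (X i)

section Interpolate

variable {D ι : Type*} [TopologicalSpace D] [CompactSpace D] [Fintype ι] {q : ℝ≥0∞}
  [Fact (1 ≤ q)] (X : ι → Lp ℝ q P) (φ : ι → C(D, ℝ))

lemma coeFn_interpolate : interpolate X φ =ᵐ[P] fun ω => ∑ i, X i ω • φ i := by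
  have h : ∀ᵐ ω ∂P, ∀ i, (ContinuousLinearMap.toSpanSingleton ℝ (φ i)).compLp (X i) ω =
      X i ω • φ i := ae_all_iff.2 fun i => by
    filter_upwards [ContinuousLinearMap.coeFn_compLp
      (ContinuousLinearMap.toSpanSingleton ℝ (φ i)) (X i)] with ω hω
    rw [hω, ContinuousLinearMap.toSpanSingleton_apply]
  filter_upwards [h, Lp.coeFn_finsetSum Finset.univ
    fun i => (ContinuousLinearMap.toSpanSingleton ℝ (φ i)).compLp (X i)] with ω h1 h2
  rw [interpolate, h2, Finset.sum_apply]
  exact Finset.sum_congr rfl fun i _ => h1 i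

lemma norm_interpolate_le (hq : q ≠ ∞) (hφ : ∀ i z, 0 ≤ φ i z) (hφ1 : ∀ z, ∑ i, φ i z = 1)
    {c : ℝ} (hc : 0 ≤ c) (hX : ∀ i, ‖X i‖ ≤ c) :
    ‖interpolate X φ‖ ≤ (Fintype.card ι : ℝ) ^ (1 / q.toReal) * c := by
  refine Lp.norm_le_card_rpow_mul hq Finset.univ _ X hc (fun i _ => hX i) ?_
  filter_upwards [coeFn_interpolate X φ] with ω hω M hM h
  have := norm_sum_smul_sub_sum_smul_le hφ hφ1 hφ hφ1
    (x := fun i => X i ω) (y := 0) hM fun i _ _ _ _ => by simpa using h i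
  rw [hω]
  simpa using this

lemma norm_interpolate_sub_le {κ : Type*} [Fintype κ] (Y : κ → Lp ℝ q P) (ψ : κ → C(D, ℝ))
    (hq : q ≠ ∞) (hφ : ∀ i z, 0 ≤ φ i z) (hφ1 : ∀ z, ∑ i, φ i z = 1)
    (hψ : ∀ i z, 0 ≤ ψ i z) (hψ1 : ∀ z, ∑ i, ψ i z = 1) {c : ℝ} (hc : 0 ≤ c)
    (h : ∀ i j z, φ i z ≠ 0 → ψ j z ≠ 0 → ‖X i - Y j‖ ≤ c) :
    ‖interpolate X φ - interpolate Y ψ‖ ≤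
      (Fintype.card ι * Fintype.card κ : ℝ) ^ (1 / q.toReal) * c := by
  classical
  let s : Finset (ι × κ) := {ij | ∃ z, φ ij.1 z ≠ 0 ∧ ψ ij.2 z ≠ 0}
  have hs : (s.card : ℝ) ≤ Fintype.card ι * Fintype.card κ := by
    rw [← Nat.cast_mul, ← Fintype.card_prod]
    exact_mod_cast s.card_le_univ
  refine (Lp.norm_le_card_rpow_mul hq s _ (fun ij => X ij.1 - Y ij.2) hc (fun ij hij => ?_)
    ?_).trans (by gcongr)
  · obtain ⟨z, h1, h2⟩ := (Finset.mem_filter.1 hij).2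
    exact h _ _ z h1 h2
  · have hall : ∀ᵐ ω ∂P, ∀ ij : ι × κ, (X ij.1 - Y ij.2 : Lp ℝ q P) ω = X ij.1 ω - Y ij.2 ω :=
      ae_all_iff.2 fun ij => Lp.coeFn_sub _ _
    filter_upwards [coeFn_interpolate X φ, coeFn_interpolate Y ψ, hall,
      Lp.coeFn_sub (interpolate X φ) (interpolate Y ψ)] with ω h1 h2 h3 h4 M hM h
    rw [h4, Pi.sub_apply, h1, h2]
    refine norm_sum_smul_sub_sum_smul_le hφ hφ1 hψ hψ1 hM fun i j z hi hj => ?_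
    have := h (i, j) (Finset.mem_filter.2 ⟨Finset.mem_univ _, z, hi, hj⟩)
    rwa [h3] at this

lemma compLp_eval_interpolate (z : D) :
    (ContinuousMap.evalCLM ℝ z).compLp (interpolate X φ) = ∑ i, φ i z • X i := by
  refine Lp.ext ?_
  have h : ∀ᵐ ω ∂P, ∀ i, (φ i z • X i : Lp ℝ q P) ω = φ i z * X i ω :=
    ae_all_iff.2 fun i => Lp.coeFn_smul _ _
  filter_upwards [ContinuousLinearMap.coeFn_compLp (ContinuousMap.evalCLM ℝ z) (interpolate X φ),
    coeFn_interpolate X φ, Lp.coeFn_finsetSum Finset.univ fun i => φ i z • X i, h]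
    with ω h1 h2 h3 h4
  rw [h1, h2, h3, Finset.sum_apply]
  simp [h4, mul_comm]

lemma norm_compLp_eval_interpolate_sub_le (hφ : ∀ i z, 0 ≤ φ i z) (hφ1 : ∀ z, ∑ i, φ i z = 1)
    (z : D) (x : Lp ℝ q P) {c : ℝ} (h : ∀ i, φ i z ≠ 0 → ‖X i - x‖ ≤ c) :
    ‖(ContinuousMap.evalCLM ℝ z).compLp (interpolate X φ) - x‖ ≤ c := by
  have hx : ∑ i, φ i z • X i - x = ∑ i, φ i z • (X i - x) := by
    simp_rw [smul_sub]
    rw [Finset.sum_sub_distrib, ← Finset.sum_smul, hφ1, one_smul]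
  rw [compLp_eval_interpolate, hx]
  calc ‖∑ i, φ i z • (X i - x)‖ ≤ ∑ i, φ i z * c := by
        refine (norm_sum_le _ _).trans (Finset.sum_le_sum fun i _ => ?_)
        rw [norm_smul, Real.norm_of_nonneg (hφ i z)]
        by_cases hi : φ i z = 0
        · simp [hi]
        · exact mul_le_mul_of_nonneg_left (h i hi) (hφ i z)
    _ = c := by rw [← Finset.sum_mul, hφ1, one_mul]

end Interpolate

lemma compLp_eq_of_tendsto {E F : Type*} [NormedAddCommGroup E] [NormedSpace ℝ E]
    [NormedAddCommGroup F] [NormedSpace ℝ F] {q : ℝ≥0∞} [Fact (1 ≤ q)] (T : E →L[ℝ] F)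
    {f : ℕ → Lp E q P} {g : Lp E q P} (hfg : Tendsto f atTop (𝓝 g)) {x : Lp F q P} {c : ℕ → ℝ}
    (hc : Tendsto c atTop (𝓝 0)) (h : ∀ n, ‖T.compLp (f n) - x‖ ≤ c n) : T.compLp g = x := by
  have h1 : Tendsto (fun n => T.compLp (f n)) atTop (𝓝 (T.compLp g)) :=
    ((T.compLpL q P).continuous.tendsto g).comp hfg
  refine tendsto_nhds_unique h1 ?_
  rw [tendsto_iff_norm_sub_tendsto_zero]
  exact squeeze_zero (fun _ => norm_nonneg _) h hc

/-- **Kolmogorov-Chentsov**: a random field with Hölder continuous `L^q` increments has a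
continuous version, whose supremum is bounded in `L^q` by the Hölder constant. -/
theorem exists_continuous_version {D : Type*} [PseudoMetricSpace D] [CompactSpace D] {q : ℝ≥0∞}
    [Fact (1 ≤ q)] (hq : q ≠ ∞) {γ : ℝ} (hγ : 0 < γ) (hγq : 6 < γ * q.toReal) {A : ℝ}
    (ι : ℕ → Type) [∀ n, Fintype (ι n)] (p : ∀ n, ι n → D)
    (hp : ∀ n z, ∃ i, dist z (p n i) < (1 / 2) ^ n)
    (hcard : ∀ n, (Fintype.card (ι n) : ℝ) ≤ A * 8 ^ n) :
    ∃ C : ℝ, ∀ (X : D → Lp ℝ q P) (K : ℝ), 0 ≤ K → (∀ z, ‖X z‖ ≤ K) →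
      (∀ z w, ‖X z - X w‖ ≤ K * dist z w ^ γ) →
      ∃ Y : Lp C(D, ℝ) q P, (∀ z, (fun ω => Y ω z) =ᵐ[P] X z) ∧ ‖Y‖ ≤ C * K := by
  have hq0 : q ≠ 0 := (zero_lt_one.trans_le Fact.out).ne'
  have hqp : 0 < q.toReal := ENNReal.toReal_pos hq0 hq
  choose φ hφ hφ1 hφd using fun n => exists_partition_of_net (p n) (hp n)
  have hA : 0 ≤ A := by simpa using (Nat.cast_nonneg _).trans (hcard 0)
  set θ : ℝ := 1 / q.toReal with hθ
  have hθ0 : 0 < θ := by positivity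
  -- Levels `n` and `n + 1` have of order `8 ^ n * 8 ^ n` pairs of points, and increments there are
  -- of order `2 ^ (-γ n)`. The ratio is below `1` exactly when `6 < γ q`.
  set ρ : ℝ := 64 ^ θ * (1 / 2) ^ γ with hρ
  have hρ1 : ρ < 1 := by
    have h1 : (64 : ℝ) ^ θ = 2 ^ (6 * θ) := by
      rw [Real.rpow_mul (by norm_num)]; norm_num
    rw [hρ, h1, Real.div_rpow (by norm_num) (by norm_num), Real.one_rpow, mul_one_div,
      ← Real.rpow_sub (by norm_num)]
    refine Real.rpow_lt_one_of_one_lt_of_neg (by norm_num) ?_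
    rw [hθ, mul_one_div, sub_neg, div_lt_iff₀ hqp]
    exact hγq
  -- The `8` comes from the finer level having `8 ^ (n + 1)` points; `2 ^ γ` from points with
  -- overlapping supports being within `2 * (1 / 2) ^ n`.
  set C₁ : ℝ := (8 * A ^ 2) ^ θ * 2 ^ γ with hC₁
  refine ⟨A ^ θ + C₁ / (1 - ρ), fun X K hK hX hXX => ?_⟩
  let F (n : ℕ) : Lp C(D, ℝ) q P := interpolate (fun i => X (p n i)) (φ n)
  have hF0 : ‖F 0‖ ≤ A ^ θ * K := by
    refine (norm_interpolate_le _ _ hq (hφ 0) (hφ1 0) hK fun i => hX _).trans ?_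
    gcongr
    simpa using hcard 0
  have hstep (n : ℕ) : dist (F n) (F (n + 1)) ≤ C₁ * K * ρ ^ n := by
    rw [dist_eq_norm]
    refine (norm_interpolate_sub_le _ _ _ _ hq (hφ n) (hφ1 n) (hφ (n + 1)) (hφ1 (n + 1))
      (c := K * (2 * (1 / 2) ^ n) ^ γ) (by positivity) fun i j z h1 h2 => ?_).trans ?_
    · refine (hXX _ _).trans ?_
      gcongr
      have h3 := hφd _ _ _ h1
      have h4 := hφd _ _ _ h2
      have h5 := dist_triangle_left (p n i) (p (n + 1) j) z
      have h6 : ((1 : ℝ) / 2) ^ (n + 1) ≤ (1 / 2) ^ n :=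
        pow_le_pow_of_le_one (by norm_num) (by norm_num) n.le_succ
      linarith
    · have hs : (Fintype.card (ι n) * Fintype.card (ι (n + 1)) : ℝ) ≤ 8 * A ^ 2 * 64 ^ n := by
        calc (Fintype.card (ι n) * Fintype.card (ι (n + 1)) : ℝ)
            ≤ (A * 8 ^ n) * (A * 8 ^ (n + 1)) :=
              mul_le_mul (hcard n) (hcard (n + 1)) (by positivity) (by positivity)
          _ = 8 * A ^ 2 * (8 * 8) ^ n := by rw [mul_pow]; ring
          _ = _ := by norm_num
      calc (Fintype.card (ι n) * Fintype.card (ι (n + 1)) : ℝ) ^ θ * (K * (2 * (1 / 2) ^ n) ^ γ)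
          ≤ (8 * A ^ 2 * 64 ^ n) ^ θ * (K * (2 * (1 / 2) ^ n) ^ γ) := by gcongr
        _ = C₁ * K * ρ ^ n := by
            rw [Real.mul_rpow (by positivity) (by positivity),
              Real.mul_rpow (x := 2) (by norm_num) (by positivity), hC₁, hρ, mul_pow,
              Real.rpow_pow_comm (by norm_num), Real.rpow_pow_comm (by norm_num)]
            ring
  obtain ⟨Y, hY⟩ := cauchySeq_tendsto_of_complete (cauchySeq_of_le_geometric ρ _ hρ1 hstep)
  refine ⟨Y, fun z => ?_, ?_⟩
  · have hl : (ContinuousMap.evalCLM ℝ z).compLp Y = X z := by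
      -- The value at `z` of the level-`n` interpolation averages `X` over points within `(1 / 2) ^
      -- n` of `z`.
      have h2 : Tendsto (fun n : ℕ => K * (((1 : ℝ) / 2) ^ n) ^ γ) atTop (𝓝 0) := by
        have := (tendsto_pow_atTop_nhds_zero_of_lt_one (r := (1 : ℝ) / 2) (by norm_num)
          (by norm_num)).rpow_const (p := γ) (Or.inr hγ.le)
        rw [Real.zero_rpow hγ.ne'] at this
        simpa using this.const_mul K
      refine compLp_eq_of_tendsto _ hY h2 fun n => ?_
      refine norm_compLp_eval_interpolate_sub_le _ _ (hφ n) (hφ1 n) z _ fun i hi => ?_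
      refine (hXX _ _).trans ?_
      gcongr
      rw [dist_comm]
      exact (hφd n i z hi).le
    rw [← hl]
    filter_upwards [ContinuousLinearMap.coeFn_compLp (ContinuousMap.evalCLM ℝ z) Y] with ω hω
    exact hω.symm
  · have h1 := dist_le_of_le_geometric_of_tendsto₀ ρ _ hρ1 hstep hY
    rw [dist_comm, dist_eq_norm] at h1
    calc ‖Y‖ = ‖(Y - F 0) + F 0‖ := by rw [sub_add_cancel]
      _ ≤ ‖Y - F 0‖ + ‖F 0‖ := norm_add_le _ _
      _ ≤ C₁ * K / (1 - ρ) + A ^ θ * K := add_le_add h1 hF0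
      _ = (A ^ θ + C₁ / (1 - ρ)) * K := by ring

lemma exists_net_Icc {R : ℝ} (hR : 0 < R) {N : ℕ} (hN : 0 < N) :
    ∃ p : Fin (N + 1) → Set.Icc (0 : ℝ) R, ∀ x, ∃ i, dist x (p i) ≤ R / N := by
  have hN' : (0 : ℝ) < N := by exact_mod_cast hN
  refine ⟨fun i => ⟨i * (R / N), by positivity, ?_⟩, fun x => ?_⟩
  · have : (i : ℝ) ≤ N := by exact_mod_cast Nat.lt_succ_iff.1 i.2
    calc (i : ℝ) * (R / N) ≤ N * (R / N) := by gcongr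
      _ = R := by field_simp
  · have hx0 : 0 ≤ (x : ℝ) / (R / N) := div_nonneg x.2.1 (by positivity)
    have hle : ⌊(x : ℝ) / (R / N)⌋₊ ≤ N := by
      refine Nat.floor_le_of_le ?_
      rw [div_le_iff₀ (by positivity), mul_div_cancel₀ _ hN'.ne']
      exact x.2.2
    refine ⟨⟨⌊(x : ℝ) / (R / N)⌋₊, Nat.lt_succ_of_le hle⟩, ?_⟩
    have h1 := Nat.floor_le hx0
    have h2 := Nat.lt_floor_add_one ((x : ℝ) / (R / N))
    rw [le_div_iff₀ (by positivity)] at h1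
    rw [div_lt_iff₀ (by positivity)] at h2
    rw [Subtype.dist_eq, Real.dist_eq, abs_of_nonneg (by simpa using h1)]
    simp only
    linarith

/-- An integer `m` above both side lengths makes the mesh at level `n` strictly smaller than `2 ^
(-n)` with `O(8 ^ n)` points. -/
lemma exists_nets_Domain {T L : ℝ} (hT : 0 < T) (hL : 0 < L) :
    ∃ (m : ℕ) (p : ∀ n : ℕ, Fin (m * 2 ^ n + 1) × Fin (m * 2 ^ n + 1) × Fin (m * 2 ^ n + 1) →
      Domain T L), ∀ n z, ∃ i, dist z (p n i) < (1 / 2) ^ n := by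
  obtain ⟨m, hm⟩ := exists_nat_gt (max T L)
  have hm0 : 0 < m := by
    have : (0 : ℝ) < m := (hT.trans_le (le_max_left _ _)).trans hm
    exact_mod_cast this
  have hN (n : ℕ) : 0 < m * 2 ^ n := by positivity
  have hlt {R : ℝ} (hR : R < m) (n : ℕ) : R / (m * 2 ^ n : ℕ) < (1 / 2) ^ n := by
    have : (0 : ℝ) < m := by exact_mod_cast hm0
    push_cast
    rw [one_div, inv_pow, div_lt_iff₀ (by positivity)]
    field_simp
    exact hR
  choose u hu using fun n => exists_net_Icc hT (hN n)
  choose v hv using fun n => exists_net_Icc hL (hN n)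
  refine ⟨m, fun n i => (u n i.1, v n i.2.1, v n i.2.2), fun n z => ?_⟩
  obtain ⟨i, hi⟩ := hu n z.1
  obtain ⟨j, hj⟩ := hv n z.2.1
  obtain ⟨k, hk⟩ := hv n z.2.2
  have hT' := hlt ((le_max_left _ _).trans_lt hm) n
  have hL' := hlt ((le_max_right _ _).trans_lt hm) n
  exact ⟨(i, j, k), max_lt (hi.trans_lt hT') (max_lt (hj.trans_lt hL') (hk.trans_lt hL'))⟩

end KolmogorovChentsov

/-! ### Continuous versions with a bound uniform in the coefficients. -/

section Versions

/-! ### Continuous versions of the stochastic convolution -/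

variable {Ω : Type*} [MeasurableSpace Ω] {P : Measure Ω} {β : Mode → ℝ≥0 → Ω → ℝ} {L : ℝ}

lemma memLp_of_mem_gaussSpace (hβ : IsCylindricalWiener β P) {X : Lp ℝ 2 P}
    (hX : X ∈ gaussSpace β P) {q : ℝ≥0∞} (hq : q ≠ ∞) : MemLp X q P :=
  ⟨Lp.aestronglyMeasurable X, (eLpNorm_le_of_mem_gaussSpace hβ hX hq).trans_lt
    (ENNReal.mul_lt_top enorm_lt_top (memLp_id_gaussianReal' q hq).eLpNorm_lt_top)⟩

lemma norm_toLp_le_of_mem_gaussSpace (hβ : IsCylindricalWiener β P) {X : Lp ℝ 2 P}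
    (hX : X ∈ gaussSpace β P) {q : ℝ≥0∞} (hq : q ≠ ∞) (h : MemLp X q P) :
    ‖h.toLp X‖ ≤ (eLpNorm id q (gaussianReal 0 1)).toReal * ‖X‖ := by
  rw [Lp.norm_toLp, mul_comm, ← toReal_enorm X, ← ENNReal.toReal_mul]
  exact ENNReal.toReal_mono
    (ENNReal.mul_ne_top enorm_ne_top (memLp_id_gaussianReal' q hq).eLpNorm_ne_top)
    (eLpNorm_le_of_mem_gaussSpace hβ hX hq)

/-- The constant precedes `a`, and `M` only secures convergence of the series: the norm is
controlled by the weighted sum alone. The threshold `48` is `6 / γ` with `γ = 1 / 8`. -/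
lemma exists_continuous_version_stochConv [IsProbabilityMeasure P]
    (hβ : IsCylindricalWiener β P) (hL : 0 < L) {T : ℝ}
    (hT : 0 < T) {q : ℝ≥0∞} [Fact (1 ≤ q)] (hq : q ≠ ∞) (hq48 : 48 < q.toReal) :
    ∃ C : ℝ, ∀ (a : Mode → ℝ) (M : ℝ), (∀ k, |a k| ≤ M) →
      ∃ Y : Lp C(Domain T L, ℝ) q P,
        (∀ z, (fun ω => Y ω z) =ᵐ[P] stochConv L β P a z.1 (z.2.1, z.2.2)) ∧
        ‖Y‖ ≤ C * Real.sqrt (∑' k : Mode, a k ^ 2 * (k.len ^ 3)⁻¹) := by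
  obtain ⟨m, p, hp⟩ := exists_nets_Domain hT hL
  have hcard (n : ℕ) : (Fintype.card
      (Fin (m * 2 ^ n + 1) × Fin (m * 2 ^ n + 1) × Fin (m * 2 ^ n + 1)) : ℝ) ≤
      ((m : ℝ) + 1) ^ 3 * 8 ^ n := by
    have h1 : (1 : ℝ) ≤ 2 ^ n := one_le_pow₀ (by norm_num)
    have h2 : (8 : ℝ) ^ n = (2 ^ n) ^ 3 := by rw [← pow_mul, mul_comm, pow_mul]; norm_num
    simp only [Fintype.card_prod, Fintype.card_fin]
    push_cast
    rw [h2, ← mul_pow]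
    calc ((m : ℝ) * 2 ^ n + 1) * ((m * 2 ^ n + 1) * (m * 2 ^ n + 1))
        = (m * 2 ^ n + 1) ^ 3 := by ring
      _ ≤ ((m + 1) * 2 ^ n) ^ 3 := by
        gcongr
        linarith
  obtain ⟨C, hC⟩ := exists_continuous_version (P := P) hq (γ := 1 / 8) (by norm_num)
    (by linarith) _ p hp hcard
  set N := (eLpNorm id q (gaussianReal 0 1)).toReal with hN
  set G : ℝ := Metric.diam (Set.univ : Set (Domain T L)) ^ (1 / 4 : ℝ) with hG
  set C₀ : ℝ := 4 / L ^ 2 * (L / (2 * Real.pi)) ^ 4 with hC₀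
  set C₁ : ℝ := (8 + 32 * G ^ 3) / L ^ 2 * (L / (2 * Real.pi)) ^ 3 with hC₁
  have hπ := Real.pi_pos
  have hG0 : 0 ≤ G := Real.rpow_nonneg Metric.diam_nonneg _
  refine ⟨C * (N * Real.sqrt (max C₀ C₁)), fun a M ha => ?_⟩
  set S : ℝ := ∑' k : Mode, a k ^ 2 * (k.len ^ 3)⁻¹ with hS
  have hS0 : 0 ≤ S := tsum_nonneg fun k => by have := k.one_le_len; positivity
  let s (z : Domain T L) : Lp ℝ 2 P := stochConv L β P a z.1 (z.2.1, z.2.2)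
  have hs (z) : s z ∈ gaussSpace β P := stochConv_mem_gaussSpace hβ hL ha z.1.2.1 _
  have hm (z) : MemLp (s z) q P := memLp_of_mem_gaussSpace hβ (hs z) hq
  have hX (z) : ‖(hm z).toLp (s z)‖ ≤ N * Real.sqrt (max C₀ C₁ * S) := by
    refine (norm_toLp_le_of_mem_gaussSpace hβ (hs z) hq _).trans ?_
    gcongr
    refine Real.le_sqrt_of_sq_le ((norm_sq_stochConv_le hβ hL ha z.1.2.1 _).trans ?_)
    gcongr
    exact le_max_left _ _
  have hXX (z w) : ‖(hm z).toLp (s z) - (hm w).toLp (s w)‖ ≤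
      N * Real.sqrt (max C₀ C₁ * S) * dist z w ^ (1 / 8 : ℝ) := by
    -- The increment lies in the Gaussian subspace as well, so the moment comparison applies to it
    -- directly.
    have hd : (hm z).toLp (s z) - (hm w).toLp (s w) =
        (memLp_of_mem_gaussSpace hβ ((gaussSpace β P).sub_mem (hs z) (hs w)) hq).toLp _ := by
      rw [← MemLp.toLp_sub]
      exact MemLp.toLp_congr _ _ (Lp.coeFn_sub _ _).symm
    rw [hd, mul_assoc]
    refine (norm_toLp_le_of_mem_gaussSpace hβ ((gaussSpace β P).sub_mem (hs z) (hs w)) hq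
      _).trans ?_
    gcongr
    have hg4 : (dist z w ^ (1 / 4 : ℝ)) ^ 4 = dist z w := by
      rw [← Real.rpow_natCast, ← Real.rpow_mul dist_nonneg]
      norm_num
    have hg2 : Real.sqrt (dist z w ^ (1 / 4 : ℝ)) = dist z w ^ (1 / 8 : ℝ) := by
      rw [Real.sqrt_eq_rpow, ← Real.rpow_mul dist_nonneg]
      norm_num
    rw [← hg2, ← Real.sqrt_mul (mul_nonneg (le_max_of_le_left (by positivity)) hS0)]
    refine Real.le_sqrt_of_sq_le ((norm_sq_stochConv_sub_le hβ hL ha z.1.2.1 w.1.2.1 _ _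
      (g := dist z w ^ (1 / 4 : ℝ)) (G := G) (by positivity) ?_ ?_ ?_).trans ?_)
    · exact Real.rpow_le_rpow dist_nonneg (Metric.dist_le_diam_of_mem
        isCompact_univ.isBounded (Set.mem_univ _) (Set.mem_univ _)) (by norm_num)
    · rw [hg4]
      exact le_max_left _ _
    · rw [hg4]
      exact le_max_right _ _
    · gcongr
      exact le_max_right _ _
  obtain ⟨Y, hY, hYC⟩ := hC (fun z => (hm z).toLp (s z)) (N * Real.sqrt (max C₀ C₁ * S))
    (by positivity) hX hXX
  refine ⟨Y, fun z => (hY z).trans (hm z).coeFn_toLp, hYC.trans_eq ?_⟩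
  rw [Real.sqrt_mul (le_max_of_le_left (by positivity))]
  ring

lemma ae_eq_of_forall_eval_ae_eq {D : Type*} [TopologicalSpace D] [TopologicalSpace.SeparableSpace D]
    {Y Z : Ω → C(D, ℝ)} (h : ∀ z, (fun ω => Y ω z) =ᵐ[P] fun ω => Z ω z) : Y =ᵐ[P] Z := by
  obtain ⟨s, hs, hd⟩ := TopologicalSpace.exists_countable_dense D
  have := hs.to_subtype
  filter_upwards [ae_all_iff.2 fun z : s => h z] with ω hω
  exact DFunLike.coe_injective ((Y ω).continuous.ext_on hd (Z ω).continuous fun z hz => hω ⟨z, hz⟩)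

/-- Dominated convergence, with majorant `(M + 1)² |k|⁻³`. -/
lemma tendsto_tsum_sq_sub_one {α : ℝ → Mode → ℝ} (hα : IsRegularization α) :
    Tendsto (fun ε => ∑' k : Mode, (α ε - 1) k ^ 2 * (k.len ^ 3)⁻¹) (𝓝[>] 0) (𝓝 0) := by
  obtain ⟨M, hM⟩ := hα.bounded
  have h : Tendsto (fun ε => ∑' k : Mode, (α ε - 1) k ^ 2 * (k.len ^ 3)⁻¹) (𝓝[>] 0)
      (𝓝 (∑' _ : Mode, 0)) := by
    refine tendsto_tsum_of_dominated_convergence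
      (summable_inv_len_pow_three.mul_left ((M + 1) ^ 2)) (fun k => ?_) ?_
    · simpa using (((hα.tendsto_one k).sub_const 1).pow 2).mul_const (k.len ^ 3)⁻¹
    · filter_upwards [self_mem_nhdsWithin] with ε hε k
      have := k.one_le_len
      rw [norm_mul, norm_pow, Real.norm_of_nonneg (by positivity : (0 : ℝ) ≤ (k.len ^ 3)⁻¹)]
      gcongr
      refine (norm_sub_le _ _).trans ?_
      simpa using hM ε hε k
  simpa using h

end Versions

end

end ThinFilm

/-! ### Convergence of the regularized fields. -/

theorem mainTheorem8 {Ω : Type*} [MeasurableSpace Ω] (P : Measure Ω) [IsProbabilityMeasure P]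
    (L : ℝ) (hL : 0 < L)
    (β : ThinFilm.Mode → ℝ≥0 → Ω → ℝ) (hβ : ThinFilm.IsCylindricalWiener β P)
    (α : ℝ → ThinFilm.Mode → ℝ) (hα : ThinFilm.IsRegularization α)
    (T : ℝ) (hT : 0 < T) (p : ℝ) (hp : 1 < p) :
    ∃ (Z : Ω → C(ThinFilm.Domain T L, ℝ)) (Zreg : ℝ → Ω → C(ThinFilm.Domain T L, ℝ)),
      ThinFilm.IsContinuousVersion T L β P (fun _ => 1) Z ∧
      MemLp Z (ENNReal.ofReal p) P ∧
      (∀ ε, 0 < ε → ThinFilm.IsContinuousVersion T L β P (α ε) (Zreg ε) ∧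
        MemLp (Zreg ε) (ENNReal.ofReal p) P) ∧
      Tendsto (fun ε => eLpNorm (Zreg ε - Z) (ENNReal.ofReal p) P) (𝓝[>] 0) (𝓝 0) := by
  open ThinFilm in
  -- Any exponent above `48` and at least `p` would do; on a probability space the result descends
  -- from `q` to `p`.
  set q : ℝ≥0∞ := ENNReal.ofReal (max p 64) with hq
  have hpq : ENNReal.ofReal p ≤ q := ENNReal.ofReal_le_ofReal (le_max_left _ _)
  have : Fact (1 ≤ q) := ⟨by
    rw [hq, ← ENNReal.ofReal_one]
    exact ENNReal.ofReal_le_ofReal (hp.le.trans (le_max_left _ _))⟩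
  have hq48 : 48 < q.toReal := by
    rw [hq, ENNReal.toReal_ofReal (by positivity)]
    exact lt_max_of_lt_right (by norm_num)
  obtain ⟨C, hC⟩ := exists_continuous_version_stochConv hβ hL hT ENNReal.ofReal_ne_top hq48
  obtain ⟨M, hM⟩ := hα.bounded
  have h1 (k : Mode) : |(fun _ => 1 : Mode → ℝ) k| ≤ 1 := by simp
  have hsub (ε : ℝ) (hε : 0 < ε) (k : Mode) : |(α ε - 1) k| ≤ M + 1 :=
    (abs_sub (α ε k) 1).trans (by simpa using hM ε hε k)
  obtain ⟨Z, hZ, -⟩ := hC (fun _ => 1) 1 h1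
  have hreg (ε : ℝ) : ∃ Y : Lp C(Domain T L, ℝ) q P, 0 < ε →
      ∀ z, (fun ω => Y ω z) =ᵐ[P] stochConv L β P (α ε) z.1 (z.2.1, z.2.2) := by
    by_cases hε : 0 < ε
    · obtain ⟨Y, hY, -⟩ := hC (α ε) M (hM ε hε)
      exact ⟨Y, fun _ => hY⟩
    · exact ⟨0, fun h => absurd h hε⟩
  choose Y hY using hreg
  refine ⟨Z, fun ε => Y ε, ⟨fun z => summable_convTerm hβ hL h1 z.1.2.1 _, hZ⟩,
    (Lp.memLp Z).mono_exponent hpq, fun ε hε =>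
      ⟨⟨fun z => summable_convTerm hβ hL (hM ε hε) z.1.2.1 _, hY ε hε⟩,
        (Lp.memLp (Y ε)).mono_exponent hpq⟩, ?_⟩
  have hlim : Tendsto (fun ε => ENNReal.ofReal
      (C * Real.sqrt (∑' k : Mode, (α ε - 1) k ^ 2 * (k.len ^ 3)⁻¹))) (𝓝[>] 0) (𝓝 0) := by
    have := ENNReal.tendsto_ofReal ((tendsto_tsum_sq_sub_one hα).sqrt.const_mul C)
    simpa using this
  refine tendsto_of_tendsto_of_tendsto_of_le_of_le' tendsto_const_nhds hlim
    (Eventually.of_forall fun _ => zero_le) ?_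
  filter_upwards [self_mem_nhdsWithin] with ε hε
  -- `W` is a version of the difference field carrying the quantitative bound. `Y ε - Z` agrees with
  -- it almost surely at each point, hence almost surely as a function, both being continuous on a
  -- separable space.
  obtain ⟨W, hW, hWC⟩ := hC (α ε - 1) (M + 1) (hsub ε hε)
  have hae : (Y ε - Z : Ω → C(Domain T L, ℝ)) =ᵐ[P] W := by
    refine ae_eq_of_forall_eval_ae_eq fun z => ?_
    have hs : stochConv L β P (α ε - 1) z.1 (z.2.1, z.2.2) = _ :=
      stochConv_sub hβ hL (hM ε hε) h1 z.1.2.1 _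
    have hc := Lp.coeFn_sub (stochConv L β P (α ε) z.1 (z.2.1, z.2.2))
      (stochConv L β P (fun _ => 1) z.1 (z.2.1, z.2.2))
    rw [← hs] at hc
    filter_upwards [hY ε hε z, hZ z, hW z, hc] with ω h2 h3 h4 h5
    rw [h4, h5, Pi.sub_apply, Pi.sub_apply, ContinuousMap.sub_apply, h2, h3]
  calc eLpNorm (Y ε - Z : Ω → C(Domain T L, ℝ)) (ENNReal.ofReal p) P
      = eLpNorm W (ENNReal.ofReal p) P := eLpNorm_congr_ae hae
    _ ≤ eLpNorm W q P := eLpNorm_le_eLpNorm_of_exponent_le hpq (Lp.aestronglyMeasurable W)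
    _ = ENNReal.ofReal ‖W‖ := by rw [← Lp.enorm_def, ofReal_norm]
    _ ≤ _ := ENNReal.ofReal_le_ofReal hWC
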